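/- Let $G$ be one of the compact groups $\mathrm{SU}(n)$ with $n\ge 2$, $\mathrm{Sp}(n)$ with $n\ge 1$, or $\mathrm{SO}(n)$ with $n\ge 4$, realised as a group of complex $N\times N$ matrices by its standard representation ($N=n$ for $\mathrm{SU}(n)$ and $\mathrm{SO}(n)$; $N=2n$ for $\mathrm{Sp}(n)$, as the unitary matrices of block form $\begin{pmatrix} z & w\\ -\bar w & \bar z\end{pmatrix}$). Equip $G$ with the left-invariant Riemannian metric induced by the scalar product $\langle Z,W\rangle=\mathrm{Re}\,\mathrm{tr}(ZW^*)$ on its Lie algebra, and let $\tau$ be the corresponding Laplace–Beltrami operator, acting on complex-valued functions. A smooth function $u:W\to\mathbb{C}$ on an open set $W\subseteq G$ is called proper biharmonic if $\tau(\tau(u))=0$ on $W$ and $\tau(u)$ does not vanish identically on $W$. Put $m=n-1$, except that $m=1$ for $G=\mathrm{Sp}(1)$. Then for every tuple $(d_1,\dots,d_m)$ of non-negative integers that are not all zero there exist linear combinations $P_1,\dots,P_m,Q$, with complex coefficients, of the matrix coefficients $g\mapsto g_{j\alpha}$ of $G$, such that the open set $W=\{g\in G: Q(g)\neq 0\}$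 is dense in $G$ and the quotients $f_i=P_i/Q$ are linearly independent proper biharmonic functions on $W$, and there exist complex numbers $c_{k_1,\dots,k_m}$ with $c_{0,\dots,0}\ne 0$, such that the multi-homogeneous polynomial $$\Phi=\sum_{k_1=0}^{d_1}\cdots\sum_{k_m=0}^{d_m}c_{k_1,\dots,k_m}\,f_1^{d_1-k_1}\tau(f_1)^{k_1}\cdots f_m^{d_m-k_m}\tau(f_m)^{k_m}$$ is a proper biharmonic function on the dense open subset $W$ of $G$. -/

import Mathlib

open scoped Matrix

noncomputable section

namespace MatrixGroup

/-- A group of invertible complex matrices, presented together with its Lie algebra, which is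
required to consist of exactly those matrices `Z` whose one-parameter group `s ↦ exp (s Z)` stays
in the group. -/
structure MatrixLieGroup (ι : Type*) [Fintype ι] [DecidableEq ι] where
  /-- the group -/
  carrier : Submonoid (Matrix ι ι ℂ)
  /-- its Lie algebra -/
  lie : Submodule ℝ (Matrix ι ι ℂ)
  mem_lie_iff : ∀ Z, Z ∈ lie ↔ ∀ s : ℝ, NormedSpace.exp (s • Z) ∈ carrier

/-- The Euclidean scalar product `Re tr (Z W*)` on complex matrices. -/
def frob {ι : Type*} [Fintype ι] (Z W : Matrix ι ι ℂ) : ℝ := (Z * Wᴴ).trace.re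

theorem frob_eq_sum {ι : Type*} [Fintype ι] (Z W : Matrix ι ι ℂ) :
    frob Z W = ∑ i, ∑ j, ((Z i j).re * (W i j).re + (Z i j).im * (W i j).im) := by
  simp [frob, Matrix.trace, Matrix.mul_apply, Complex.mul_re]

/-- Every real subspace of the space of matrices has an orthonormal basis. -/
theorem exists_orthonormal_basis {ι : Type*} [Fintype ι] (V : Submodule ℝ (Matrix ι ι ℂ)) :
    ∃ b : Module.Basis (Fin (Module.finrank ℝ V)) ℝ V,
      ∀ i j, frob (b i : Matrix ι ι ℂ) (b j) = if i = j then 1 else 0 := by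
  let core : InnerProductSpace.Core ℝ V :=
    { inner := fun x y => frob (x : Matrix ι ι ℂ) y
      conj_inner_symm := fun x y => by
        simp only [frob_eq_sum, conj_trivial]
        refine Finset.sum_congr rfl fun i _ => Finset.sum_congr rfl fun j _ => ?_
        ring
      re_inner_nonneg := fun x => by
        simp only [frob_eq_sum, RCLike.re_to_real]
        refine Finset.sum_nonneg fun i _ => Finset.sum_nonneg fun j _ => ?_
        nlinarith [mul_self_nonneg ((x : Matrix ι ι ℂ) i j).re,
          mul_self_nonneg ((x : Matrix ι ι ℂ) i j).im]
      add_left := fun x y z => by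
        simp [frob, Matrix.add_mul]
      smul_left := fun x y r => by
        simp [frob, Matrix.trace_smul]
      definite := fun x hx => by
        have h0 : ∀ i j, 0 ≤ ((x : Matrix ι ι ℂ) i j).re * ((x : Matrix ι ι ℂ) i j).re +
            ((x : Matrix ι ι ℂ) i j).im * ((x : Matrix ι ι ℂ) i j).im := fun i j =>
          add_nonneg (mul_self_nonneg _) (mul_self_nonneg _)
        have hx' : frob (x : Matrix ι ι ℂ) x = 0 := hx
        rw [frob_eq_sum, Finset.sum_eq_zero_iff_of_nonneg
          (fun i _ => Finset.sum_nonneg fun j _ => h0 i j)] at hx'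
        apply Subtype.ext
        ext i j
        have h1 := (Finset.sum_eq_zero_iff_of_nonneg (fun j _ => h0 i j)).1
          (hx' i (Finset.mem_univ i)) j (Finset.mem_univ j)
        exact Complex.normSq_eq_zero.1 (by rw [Complex.normSq_apply]; exact h1) }
  let : NormedAddCommGroup V := core.toNormedAddCommGroup
  let : InnerProductSpace ℝ V := InnerProductSpace.ofCore core.toCore
  let e := stdOrthonormalBasis ℝ V
  refine ⟨e.toBasis, fun i j => ?_⟩
  have h := orthonormal_iff_ite.1 e.orthonormal i j
  rw [OrthonormalBasis.coe_toBasis]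
  exact h

variable {ι : Type*} [Fintype ι] [DecidableEq ι]

/-- An orthonormal basis of the Lie algebra, for the scalar product `Re tr (Z W*)`. -/
def frame (G : MatrixLieGroup ι) : Module.Basis (Fin (Module.finrank ℝ G.lie)) ℝ G.lie :=
  (exists_orthonormal_basis G.lie).choose

theorem frame_orthonormal (G : MatrixLieGroup ι) (i j : Fin (Module.finrank ℝ G.lie)) :
    frob (frame G i : Matrix ι ι ℂ) (frame G j) = if i = j then 1 else 0 :=
  (exists_orthonormal_basis G.lie).choose_spec i j

/-- The one-parameter subgroup `s ↦ exp (s Z)` of an element `Z` of the Lie algebra. -/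
def oneParam (G : MatrixLieGroup ι) (Z : G.lie) (s : ℝ) : G.carrier :=
  ⟨NormedSpace.exp (s • (Z : Matrix ι ι ℂ)), (G.mem_lie_iff Z).1 Z.2 s⟩

/-- The derivative `Z(u)` of a function on `G` along the left-invariant vector field `Z`. -/
def lieDeriv (G : MatrixLieGroup ι) (Z : G.lie) (u : G.carrier → ℂ) (g : G.carrier) : ℂ :=
  deriv (fun s : ℝ => u (g * oneParam G Z s)) 0

/-- The second derivative `Z²(u)` along the left-invariant vector field `Z`. -/
def lieDeriv2 (G : MatrixLieGroup ι) (Z : G.lie) (u : G.carrier → ℂ) (g : G.carrier) : ℂ :=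
  iteratedDeriv 2 (fun s : ℝ => u (g * oneParam G Z s)) 0

/-- The left-invariant vector field `∇_Z Z`, for the Levi-Civita connection of the left-invariant
metric induced by `Re tr (Z W*)`. By the Koszul formula, `⟨∇_Z Z, W⟩ = ⟨[W, Z], Z⟩` for all `W`
in the Lie algebra. -/
def nablaSelf (G : MatrixLieGroup ι) (Z : G.lie) : G.lie :=
  ∑ j, frob ((frame G j : Matrix ι ι ℂ) * (Z : Matrix ι ι ℂ) -
    (Z : Matrix ι ι ℂ) * (frame G j : Matrix ι ι ℂ)) Z • frame G j

/-- The Laplace-Beltrami operator (tension field) of `G` with the left-invariant Riemannian metric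
induced by `Re tr (Z W*)`: the trace `∑ (Z²(u) - (∇_Z Z)(u))` of the Hessian of `u` with respect to
a left-invariant orthonormal frame. -/
def tension (G : MatrixLieGroup ι) (u : G.carrier → ℂ) (g : G.carrier) : ℂ :=
  ∑ i, (lieDeriv2 G (frame G i) u g - lieDeriv G (nablaSelf G (frame G i)) u g)

/-- Smoothness on `W` of a complex-valued function on a matrix group: around every point of `W` the
function is the restriction of a smooth function of the matrix entries. -/
def SmoothOn (G : MatrixLieGroup ι) (W : Set G.carrier) (u : G.carrier → ℂ) : Prop :=
  ∀ g ∈ W, ∃ v : (ι → ι → ℂ) → ℂ,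
    ContDiffAt ℝ ((⊤ : ℕ∞) : WithTop ℕ∞) v (fun i j => (g : Matrix ι ι ℂ) i j) ∧
      ∀ᶠ h in nhds g, u h = v (fun i j => (h : Matrix ι ι ℂ) i j)

/-- `u` is a proper biharmonic function on the open set `W`: it is smooth, `τ(τ(u)) = 0` on `W`, and
`τ(u)` does not vanish identically on `W`. -/
structure IsProperBiharmonicOn (G : MatrixLieGroup ι) (W : Set G.carrier)
    (u : G.carrier → ℂ) : Prop where
  smooth : SmoothOn G W u
  biharmonic : ∀ g ∈ W, tension G (tension G u) g = 0
  proper : ∃ g ∈ W, tension G u g ≠ 0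

/-- The linear combination `∑ M_{jα} g_{jα}` of the matrix coefficients of the standard
representation of `G`. -/
def coeffComb (G : MatrixLieGroup ι) (M : Matrix ι ι ℂ) (g : G.carrier) : ℂ :=
  ∑ j, ∑ α, M j α * (g : Matrix ι ι ℂ) j α

/-- The multi-homogeneous polynomial of multidegree `d` in the pairs `f_i, τ(f_i)`, i.e.
`∑ c_{k₁,…,k_m} f₁^(d₁-k₁) τ(f₁)^k₁ ⋯ f_m^(d_m-k_m) τ(f_m)^k_m`,
the sum being over all `k` with `0 ≤ k_i ≤ d_i`. -/
def multiPoly (G : MatrixLieGroup ι) {m : ℕ} (d : Fin m → ℕ) (c : (Fin m → ℕ) → ℂ)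
    (f : Fin m → G.carrier → ℂ) (g : G.carrier) : ℂ :=
  ∑ k ∈ Finset.Iic d, c k * ∏ i, (f i g ^ (d i - k i) * tension G (f i) g ^ k i)

/-- There are linear combinations `P_1, …, P_m, Q` of matrix coefficients of `G`, with `Q ≠ 0` on a
dense open set `W`, such that the quotients `f_i = P_i / Q` are linearly independent proper
biharmonic functions on `W`, and a multi-homogeneous polynomial of multidegree `d` in the
`f_i, τ(f_i)`, in which the monomial `f_1^{d_1} ⋯ f_m^{d_m}` occurs, which is proper biharmonic
on `W`. -/
def HasBiharmonicPoly (G : MatrixLieGroup ι) {m : ℕ} (d : Fin m → ℕ) : Prop :=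
  ∃ (p : Fin m → Matrix ι ι ℂ) (q : Matrix ι ι ℂ) (c : (Fin m → ℕ) → ℂ)
    (f : Fin m → G.carrier → ℂ) (W : Set G.carrier),
    W = {g | coeffComb G q g ≠ 0} ∧ IsOpen W ∧ Dense W ∧
    (∀ i g, f i g = coeffComb G (p i) g / coeffComb G q g) ∧
    (∀ i, IsProperBiharmonicOn G W (f i)) ∧
    LinearIndependent ℂ (fun i => W.domRestrict (f i)) ∧
    c 0 ≠ 0 ∧
    IsProperBiharmonicOn G W (multiPoly G d c f)

/-! ### The Lie algebras of the classical groups -/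

open scoped Matrix.Norms.Operator in
theorem eq_of_exp_eq (X Y : Matrix ι ι ℂ)
    (h : ∀ s : ℝ, NormedSpace.exp (s • X) = NormedSpace.exp (s • Y)) : X = Y := by
  have h1 := hasDerivAt_exp_smul_const (𝕂 := ℝ) X 0
  have h2 := hasDerivAt_exp_smul_const (𝕂 := ℝ) Y 0
  have h3 := h2.congr_of_eventuallyEq (Filter.Eventually.of_forall h)
  simpa using h1.unique h3

theorem exp_smul_unitary_iff (Z : Matrix ι ι ℂ) :
    Zᴴ = -Z ↔ ∀ s : ℝ, NormedSpace.exp (s • Z) ∈ Matrix.unitaryGroup ι ℂ := by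
  have key : ∀ s : ℝ, NormedSpace.exp (s • Z) * NormedSpace.exp (s • (-Z)) = 1 := fun s => by
    rw [← Matrix.exp_add_of_commute _ _ (by
      rw [smul_neg]; exact (Commute.refl _).neg_right)]
    simp
  have hs : ∀ s : ℝ, star (NormedSpace.exp (s • Z)) = NormedSpace.exp (s • Zᴴ) := fun s => by
    rw [Matrix.star_eq_conjTranspose, ← Matrix.exp_conjTranspose, Matrix.conjTranspose_smul]
    simp
  constructor
  · intro h s
    rw [Matrix.mem_unitaryGroup_iff, hs, h, key]
  · intro h
    refine eq_of_exp_eq _ _ fun s => ?_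
    have h1 := Matrix.mem_unitaryGroup_iff'.1 (h s)
    rw [← hs]
    calc star (NormedSpace.exp (s • Z))
        = star (NormedSpace.exp (s • Z)) *
          (NormedSpace.exp (s • Z) * NormedSpace.exp (s • (-Z))) := by rw [key, mul_one]
      _ = _ := by rw [← mul_assoc, h1, one_mul]

theorem det_exp_of_skew (Z : Matrix ι ι ℂ) (h : Zᴴ = -Z) :
    (NormedSpace.exp Z).det = Complex.exp Z.trace := by
  have hH : (Complex.I • Z).IsHermitian := by
    rw [Matrix.IsHermitian, Matrix.conjTranspose_smul, h]; simp
  set U : Matrix ι ι ℂ := (hH.eigenvectorUnitary : Matrix ι ι ℂ) with hU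
  have hUU : U * star U = 1 := Unitary.coe_mul_star_self hH.eigenvectorUnitary
  have hdet : IsUnit U.det := (Matrix.isUnit_iff_isUnit_det _).1 (IsUnit.of_mul_eq_one _ hUU)
  have hinv : U⁻¹ = star U := Matrix.inv_eq_right_inv hUU
  have hsp := hH.spectral_theorem
  rw [Unitary.conjStarAlgAut_apply] at hsp
  have hZ : Z = U * Matrix.diagonal (fun i => -Complex.I * (hH.eigenvalues i : ℂ)) * U⁻¹ := by
    have : Z = (-Complex.I) • (Complex.I • Z) := by simp [smul_smul]
    rw [hinv]
    refine this.trans ((congrArg (fun A => -Complex.I • A) hsp).trans ?_)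
    rw [← Matrix.smul_mul, ← Matrix.mul_smul, ← Matrix.diagonal_smul]
    rfl
  rw [hZ, Matrix.exp_conj _ _ ((Matrix.isUnit_iff_isUnit_det _).2 hdet), Matrix.exp_diagonal,
    Matrix.det_conj ((Matrix.isUnit_iff_isUnit_det _).2 hdet), Matrix.det_diagonal,
    Matrix.trace_mul_cycle, Matrix.nonsing_inv_mul _ hdet, one_mul, Matrix.trace_diagonal,
    Complex.exp_sum]
  refine Finset.prod_congr rfl fun i _ => ?_
  rw [Pi.coe_exp, Complex.exp_eq_exp_ℂ]

theorem exp_map_star (Z : Matrix ι ι ℂ) :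
    NormedSpace.exp (Z.map star) = (NormedSpace.exp Z).map star := by
  have h : ∀ A : Matrix ι ι ℂ, A.map star = Aᴴᵀ := fun A => rfl
  rw [h, h, Matrix.exp_transpose, Matrix.exp_conjTranspose]

open scoped Matrix.Norms.Operator in
theorem exp_map_ofReal (Y : Matrix ι ι ℝ) :
    NormedSpace.exp (Y.map ((↑) : ℝ → ℂ)) = (NormedSpace.exp Y).map ((↑) : ℝ → ℂ) :=
  (NormedSpace.map_exp (Complex.ofRealHom.mapMatrix : Matrix ι ι ℝ →+* Matrix ι ι ℂ)
    (continuous_id.matrix_map Complex.continuous_ofReal) Y).symm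

/-- The special unitary group `SU(n)`. -/
def suGroup (n : ℕ) : MatrixLieGroup (Fin n) where
  carrier := Matrix.specialUnitaryGroup (Fin n) ℂ
  lie :=
    { carrier := {Z | Zᴴ = -Z ∧ Z.trace = 0}
      add_mem' := fun {a b} ha hb => by
        refine ⟨?_, ?_⟩
        · rw [Matrix.conjTranspose_add, ha.1, hb.1]; abel
        · rw [Matrix.trace_add, ha.2, hb.2, add_zero]
      zero_mem' := by simp
      smul_mem' := fun r a ha => by
        refine ⟨?_, ?_⟩
        · rw [Matrix.conjTranspose_smul, ha.1]; simp
        · rw [Matrix.trace_smul, ha.2, smul_zero] }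
  mem_lie_iff := fun Z => by
    have hdet : Zᴴ = -Z → ∀ s : ℝ,
        (NormedSpace.exp (s • Z)).det = Complex.exp (s • Z.trace) := fun h s => by
      rw [det_exp_of_skew, Matrix.trace_smul]
      rw [Matrix.conjTranspose_smul, h]; simp
    constructor
    · rintro ⟨h1, h2⟩ s
      rw [Matrix.mem_specialUnitaryGroup_iff, hdet h1, h2]
      exact ⟨(exp_smul_unitary_iff Z).1 h1 s, by simp⟩
    · intro h
      have h1 : Zᴴ = -Z := (exp_smul_unitary_iff Z).2 fun s =>
        (Matrix.mem_specialUnitaryGroup_iff.1 (h s)).1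
      refine ⟨h1, ?_⟩
      have h2 : (fun s : ℝ => NormedSpace.exp (s • Z.trace)) = fun _ => (1 : ℂ) :=
        funext fun s => by
          rw [← Complex.exp_eq_exp_ℂ, ← hdet h1, (Matrix.mem_specialUnitaryGroup_iff.1 (h s)).2]
      have h3 := hasDerivAt_exp_smul_const (𝕂 := ℝ) Z.trace 0
      rw [h2] at h3
      simpa using h3.unique (hasDerivAt_const (0 : ℝ) (1 : ℂ))

/-- The special orthogonal group `SO(n)`, regarded as a group of complex matrices. -/
def soGroup (n : ℕ) : MatrixLieGroup (Fin n) where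
  carrier := (Matrix.specialOrthogonalGroup (Fin n) ℝ).map
    (Complex.ofRealHom.mapMatrix : Matrix (Fin n) (Fin n) ℝ →+* Matrix (Fin n) (Fin n) ℂ)
  lie :=
    { carrier := {Z | ∃ Y : Matrix (Fin n) (Fin n) ℝ, Yᵀ = -Y ∧ Y.map ((↑) : ℝ → ℂ) = Z}
      add_mem' := by
        rintro _ _ ⟨Y, hY, rfl⟩ ⟨Y', hY', rfl⟩
        refine ⟨Y + Y', ?_, by ext; simp⟩
        rw [Matrix.transpose_add, hY, hY']; abel
      zero_mem' := ⟨0, by simp, by ext; simp⟩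
      smul_mem' := by
        rintro r _ ⟨Y, hY, rfl⟩
        exact ⟨r • Y, by rw [Matrix.transpose_smul, hY, smul_neg], by ext; simp⟩ }
  mem_lie_iff := fun Z => by
    have hsmul : ∀ (s : ℝ) (Y : Matrix (Fin n) (Fin n) ℝ),
        s • Y.map ((↑) : ℝ → ℂ) = (s • Y).map ((↑) : ℝ → ℂ) := fun s Y => by ext; simp
    have hct : ∀ Y : Matrix (Fin n) (Fin n) ℝ,
        (Y.map ((↑) : ℝ → ℂ))ᴴ = Yᵀ.map ((↑) : ℝ → ℂ) := fun Y => by ext; simp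
    have hinj : Function.Injective
        fun Y : Matrix (Fin n) (Fin n) ℝ => Y.map ((↑) : ℝ → ℂ) :=
      Matrix.map_injective Complex.ofReal_injective
    constructor
    · rintro ⟨Y, hY, rfl⟩ s
      have hsk : (Y.map ((↑) : ℝ → ℂ))ᴴ = -Y.map ((↑) : ℝ → ℂ) := by
        rw [hct, hY]; ext; simp
      have hu := (exp_smul_unitary_iff _).1 hsk s
      have hd := det_exp_of_skew (s • Y.map ((↑) : ℝ → ℂ)) (by
        rw [Matrix.conjTranspose_smul, hsk]; simp)
      have ht : Y.trace = 0 := by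
        have := congrArg Matrix.trace hY
        rw [Matrix.trace_transpose, Matrix.trace_neg] at this
        linarith
      have ht' : (s • Y.map ((↑) : ℝ → ℂ)).trace = 0 := by
        rw [hsmul]
        have : ((s • Y).map ((↑) : ℝ → ℂ)).trace = (((s • Y).trace : ℝ) : ℂ) := by
          simp [Matrix.trace]
        rw [this, Matrix.trace_smul, ht]; simp
      rw [ht', Complex.exp_zero] at hd
      rw [hsmul, exp_map_ofReal] at hu hd ⊢
      refine ⟨NormedSpace.exp (s • Y), ?_, rfl⟩
      refine Matrix.mem_specialOrthogonalGroup_iff.2 ⟨?_, ?_⟩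
      · rw [Matrix.mem_orthogonalGroup_iff]
        rw [Matrix.mem_unitaryGroup_iff, Matrix.star_eq_conjTranspose, hct] at hu
        apply hinj
        have h1 := Matrix.map_mul (f := Complex.ofRealHom)
          (L := NormedSpace.exp (s • Y)) (M := (NormedSpace.exp (s • Y))ᵀ)
        refine (h1.trans hu).trans ?_
        ext i j; simp [Matrix.one_apply, apply_ite]
      · have h1 := RingHom.map_det Complex.ofRealHom (NormedSpace.exp (s • Y))
        exact Complex.ofReal_injective ((h1.trans hd).trans Complex.ofReal_one.symm)
    · intro h
      choose x hx hxe using h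
      have hxe' : ∀ s, (x s).map ((↑) : ℝ → ℂ) = NormedSpace.exp (s • Z) := hxe
      have hreal : Z.map star = Z := eq_of_exp_eq _ _ fun s => by
        have : s • Z.map star = (s • Z).map star := by ext; simp
        rw [this, exp_map_star, ← hxe' s]
        ext; simp
      have hskew : Zᴴ = -Z := (exp_smul_unitary_iff Z).2 fun s => by
        rw [← hxe' s, Matrix.mem_unitaryGroup_iff, Matrix.star_eq_conjTranspose, hct]
        have h1 := Matrix.map_mul (f := Complex.ofRealHom) (L := x s) (M := (x s)ᵀ)
        have h2 := (Matrix.mem_orthogonalGroup_iff (Fin n) ℝ).1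
          (Matrix.mem_specialOrthogonalGroup_iff.1 (hx s)).1
        have h2' : x s * (x s)ᵀ = 1 := h2
        rw [h2'] at h1
        refine h1.symm.trans ?_
        ext i j; simp [Matrix.one_apply, apply_ite]
      have hZ : (Z.map Complex.re).map ((↑) : ℝ → ℂ) = Z := by
        ext i j
        have := congrFun (congrFun hreal i) j
        exact Complex.conj_eq_iff_re.1 this
      refine ⟨Z.map Complex.re, ?_, hZ⟩
      apply hinj
      change ((Z.map Complex.re)ᵀ).map ((↑) : ℝ → ℂ) = _
      rw [← hct, hZ, hskew]
      ext i j
      have := congrFun (congrFun hZ i) j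
      simp only [Matrix.map_apply, Matrix.neg_apply, Complex.ofReal_neg] at this ⊢
      rw [this]

/-- The standard complex representation of the quaternionic `n × n` matrices: the matrices with
block form `(z, w; -w̄, z̄)`. -/
def quaternionic (n : ℕ) : Subalgebra ℝ (Matrix (Fin n ⊕ Fin n) (Fin n ⊕ Fin n) ℂ) where
  carrier := {g | ∃ z w : Matrix (Fin n) (Fin n) ℂ,
    g = Matrix.fromBlocks z w (-w.map star) (z.map star)}
  mul_mem' := by
    rintro _ _ ⟨z, w, rfl⟩ ⟨z', w', rfl⟩
    have hmul : ∀ a b : Matrix (Fin n) (Fin n) ℂ,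
        (a * b).map star = a.map star * b.map star := fun a b =>
      Matrix.map_mul (f := starRingEnd ℂ)
    have hadd : ∀ a b : Matrix (Fin n) (Fin n) ℂ,
        (a + b).map star = a.map star + b.map star := fun a b => by ext; simp
    have hneg : ∀ a : Matrix (Fin n) (Fin n) ℂ, (-a).map star = -a.map star := fun a => by
      ext; simp
    have hss : ∀ a : Matrix (Fin n) (Fin n) ℂ, (a.map star).map star = a := fun a => by
      ext; simp
    refine ⟨z * z' + w * (-w'.map star), z * w' + w * z'.map star, ?_⟩
    rw [Matrix.fromBlocks_multiply]
    simp only [hmul, hadd, hneg, hss, Matrix.fromBlocks_inj]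
    refine ⟨trivial, trivial, ?_, ?_⟩ <;>
      simp only [Matrix.mul_neg, Matrix.neg_mul] <;> abel
  add_mem' := by
    rintro _ _ ⟨z, w, rfl⟩ ⟨z', w', rfl⟩
    refine ⟨z + z', w + w', ?_⟩
    rw [Matrix.fromBlocks_add, Matrix.fromBlocks_inj]
    refine ⟨rfl, rfl, ?_, ?_⟩ <;> ext <;> simp [add_comm]
  algebraMap_mem' r := by
    refine ⟨algebraMap ℝ _ r, 0, ?_⟩
    ext i j
    rcases i with i | i <;> rcases j with j | j <;>
      simp [Matrix.algebraMap_matrix_apply]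

theorem mem_quaternionic_iff (n : ℕ) (g : Matrix (Fin n ⊕ Fin n) (Fin n ⊕ Fin n) ℂ) :
    g ∈ quaternionic n ↔
      Matrix.fromBlocks 0 1 (-1) 0 * g.map star = g * Matrix.fromBlocks 0 1 (-1) 0 := by
  constructor
  · rintro ⟨z, w, rfl⟩
    rw [Matrix.fromBlocks_map, Matrix.fromBlocks_multiply, Matrix.fromBlocks_multiply,
      Matrix.fromBlocks_inj]
    refine ⟨?_, ?_, ?_, ?_⟩ <;> ext <;> simp
  · intro h
    rw [← Matrix.fromBlocks_toBlocks g, Matrix.fromBlocks_map, Matrix.fromBlocks_multiply,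
      Matrix.fromBlocks_multiply, Matrix.fromBlocks_inj] at h
    obtain ⟨-, -, h3, h4⟩ := h
    refine ⟨g.toBlocks₁₁, g.toBlocks₁₂, ?_⟩
    conv_lhs => rw [← Matrix.fromBlocks_toBlocks g]
    rw [Matrix.fromBlocks_inj]
    refine ⟨rfl, rfl, ?_, ?_⟩
    · simpa using h4.symm
    · simpa using h3.symm

/-- The quaternionic unitary group `Sp(n)`, regarded as a group of complex `2n × 2n` matrices. -/
def spGroup (n : ℕ) : MatrixLieGroup (Fin n ⊕ Fin n) where
  carrier := Matrix.unitaryGroup (Fin n ⊕ Fin n) ℂ ⊓ (quaternionic n).toSubmonoid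
  lie :=
    { carrier := {Z | Zᴴ = -Z ∧ Z ∈ quaternionic n}
      add_mem' := fun {a b} ha hb => by
        refine ⟨?_, add_mem ha.2 hb.2⟩
        rw [Matrix.conjTranspose_add, ha.1, hb.1]; abel
      zero_mem' := ⟨by simp, zero_mem _⟩
      smul_mem' := fun r a ha => by
        refine ⟨?_, (quaternionic n).smul_mem ha.2 r⟩
        rw [Matrix.conjTranspose_smul, ha.1]; simp }
  mem_lie_iff := fun Z => by
    set J : Matrix (Fin n ⊕ Fin n) (Fin n ⊕ Fin n) ℂ := Matrix.fromBlocks 0 1 (-1) 0 with hJ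
    have hJJ : J * (-J) = 1 := by
      rw [hJ, Matrix.fromBlocks_neg, Matrix.fromBlocks_multiply, ← Matrix.fromBlocks_one]
      simp
    have hJu : IsUnit J := IsUnit.of_mul_eq_one _ hJJ
    have hinv : J⁻¹ = -J := Matrix.inv_eq_right_inv hJJ
    have hJJ' : (-J) * J = 1 := by rw [Matrix.neg_mul, ← Matrix.mul_neg, hJJ]
    have hconj : ∀ A : Matrix (Fin n ⊕ Fin n) (Fin n ⊕ Fin n) ℂ,
        A ∈ quaternionic n ↔ J * A.map star * J⁻¹ = A := fun A => by
      rw [mem_quaternionic_iff, ← hJ, hinv]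
      constructor
      · intro h; rw [h, mul_assoc, hJJ, mul_one]
      · intro h
        conv_rhs => rw [← h]
        rw [mul_assoc, hJJ', mul_one]
    have hexp : ∀ s : ℝ, NormedSpace.exp (s • (J * Z.map star * J⁻¹)) =
        J * (NormedSpace.exp (s • Z)).map star * J⁻¹ := fun s => by
      have : s • (J * Z.map star * J⁻¹) = J * (s • Z).map star * J⁻¹ := by
        have h1 : (s • Z).map star = s • Z.map star := by ext; simp
        rw [h1, Matrix.mul_smul, Matrix.smul_mul]
      rw [this, Matrix.exp_conj _ _ hJu, exp_map_star]
    constructor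
    · rintro ⟨h1, h2⟩ s
      refine ⟨(exp_smul_unitary_iff Z).1 h1 s, ?_⟩
      exact (hconj _).2 (by rw [← hexp s, (hconj Z).1 h2])
    · intro h
      refine ⟨(exp_smul_unitary_iff Z).2 fun s => (h s).1, (hconj Z).2 ?_⟩
      refine eq_of_exp_eq _ _ fun s => ?_
      rw [hexp s]
      exact (hconj _).1 (h s).2

end MatrixGroup

end

noncomputable section

namespace MatrixGroup

variable {ι : Type*} [Fintype ι] [DecidableEq ι] {G : MatrixLieGroup ι}

/-! ### One-parameter subgroups -/

/-! All the Lie algebras are skew-Hermitian, so the metric is bi-invariant, `∇_Z Z = 0`, and `τ = ∑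
X_i²` over an orthonormal frame. Let `κ(u, v) = ∑ X_i(u) X_i(v)`, so that `τ(uv) = τ(u) v + 2 κ(u,
v) + u τ(v)`.

Fix vectors `x`, `a`, `y` and put `u_b = b ⬝ g x`, `v_b = b ⬝ g a`. The sum `∑ X_i ⊗ X_i` is, up to
sign, the projection onto the complexified Lie algebra (`IsLieProj.sum_mul`). For suitable `x, a`
this makes `κ` of two such coefficients a swap term with weight `-μ` plus a plain product with
weight `ν` (`CasimirPair`). Both `ν` and the eigenvalue `lam` cancel in quotients by `u_y`. Hence
`f_b = v_b / u_y` and `h_b = τ(f_b)` satisfy closed relations: `τ(h_b) = 0`, while `κ(f, f')`, `κ(f,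
h')`, `κ(h, h')` are quadratic in the `f, h` (`BiharmonicFamily`).

Let `P(X) = ∏ (f_i + h_i X)` have `δ` factors. The relations amount to `τ P = δ P' + X (1 - 2μX)
P''`, where `τ` acts coefficientwise. So `τ` acts on the coefficients `φ_0, …, φ_δ` of `P` by a
bidiagonal matrix with diagonal entries `-2μ b (b - 1)` and nonzero links `φ_b → φ_{b+1}`. The
diagonal vanishes exactly at `b = 0, 1`, and the link between these is nonzero, which gives a Jordan
block of size two at the eigenvalue zero. Its generator, normalised at `φ_0`, is the biharmonic
polynomial (`exists_coeffStep`). Expanding `P` by the binomial theorem turns it into the required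
multi-homogeneous form.

Properness is checked at the identity, where the linear forms are chosen so that `f_i = 0` and `h_i
= 2μ`, leaving only `φ_δ`. Density of `W` and linear independence of the `f_i` follow from
irreducibility of the Lie algebra action: a matrix coefficient built from nonzero vectors cannot
vanish on a nonempty open set (`eq_zero_of_matCoeff_eq_zero`). -/

open scoped Matrix.Norms.Operator in
theorem contDiff_exp_smul_apply (Z : Matrix ι ι ℂ) (i j : ι) :
    ContDiff ℝ ((⊤ : ℕ∞) : WithTop ℕ∞) (fun s : ℝ => NormedSpace.exp (s • Z) i j) := by
  have h1 : ContDiff ℝ ((⊤ : ℕ∞) : WithTop ℕ∞) (fun s : ℝ => NormedSpace.exp (s • Z)) := by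
    have h2 : ContDiff ℝ ((⊤ : ℕ∞) : WithTop ℕ∞)
        (NormedSpace.exp : Matrix ι ι ℂ → Matrix ι ι ℂ) :=
      contDiff_iff_contDiffAt.2 fun x => (NormedSpace.exp_analytic (𝕂 := ℝ) x).contDiffAt
    exact h2.comp (contDiff_id.smul contDiff_const)
  let e : Matrix ι ι ℂ →ₗ[ℝ] ℂ :=
    { toFun := fun M => M i j
      map_add' := fun _ _ => rfl
      map_smul' := fun _ _ => rfl }
  exact e.toContinuousLinearMap.contDiff.comp h1

open scoped Matrix.Norms.Operator in
theorem hasDerivAt_exp_smul_apply (Z : Matrix ι ι ℂ) (s : ℝ) (i j : ι) :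
    HasDerivAt (fun s : ℝ => NormedSpace.exp (s • Z) i j) ((NormedSpace.exp (s • Z) * Z) i j) s := by
  have h1 := hasDerivAt_exp_smul_const (𝕂 := ℝ) Z s
  let e : Matrix ι ι ℂ →ₗ[ℝ] ℂ :=
    { toFun := fun M => M i j
      map_add' := fun _ _ => rfl
      map_smul' := fun _ _ => rfl }
  exact e.toContinuousLinearMap.hasFDerivAt.comp_hasDerivAt s h1

theorem oneParam_zero (Z : G.lie) : oneParam G Z 0 = 1 := by
  apply Subtype.ext
  simp [oneParam]

theorem coe_mul_oneParam (g : G.carrier) (Z : G.lie) (s : ℝ) :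
    ((g * oneParam G Z s : G.carrier) : Matrix ι ι ℂ) =
      (g : Matrix ι ι ℂ) * NormedSpace.exp (s • (Z : Matrix ι ι ℂ)) := rfl

theorem contDiff_mul_oneParam (g : G.carrier) (Z : G.lie) :
    ContDiff ℝ ((⊤ : ℕ∞) : WithTop ℕ∞)
      (fun s : ℝ => fun i j => ((g * oneParam G Z s : G.carrier) : Matrix ι ι ℂ) i j) := by
  rw [contDiff_pi]
  intro i
  rw [contDiff_pi]
  intro j
  simp only [coe_mul_oneParam, Matrix.mul_apply]
  exact ContDiff.sum fun k _ => contDiff_const.mul (contDiff_exp_smul_apply _ _ _)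

theorem continuous_mul_oneParam (g : G.carrier) (Z : G.lie) :
    Continuous (fun s : ℝ => g * oneParam G Z s) :=
  Continuous.subtype_mk (contDiff_mul_oneParam g Z).continuous _

theorem tendsto_mul_oneParam (g : G.carrier) (Z : G.lie) :
    Filter.Tendsto (fun s : ℝ => g * oneParam G Z s) (nhds 0) (nhds g) := by
  have := (continuous_mul_oneParam g Z).tendsto 0
  simpa [oneParam_zero] using this

/-! ### Smooth functions -/

/-- Smoothness at a point of a complex-valued function on a matrix group. -/
def SmoothAt (u : G.carrier → ℂ) (g : G.carrier) : Prop :=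
  ∃ v : (ι → ι → ℂ) → ℂ,
    ContDiffAt ℝ ((⊤ : ℕ∞) : WithTop ℕ∞) v (fun i j => (g : Matrix ι ι ℂ) i j) ∧
      ∀ᶠ h in nhds g, u h = v (fun i j => (h : Matrix ι ι ℂ) i j)

theorem SmoothAt.congr {u u' : G.carrier → ℂ} {g : G.carrier} (hu : SmoothAt u g)
    (h : u' =ᶠ[nhds g] u) : SmoothAt u' g := by
  obtain ⟨v, hv, he⟩ := hu
  exact ⟨v, hv, by filter_upwards [h, he] with x h1 h2 using h1.trans h2⟩

theorem smoothAt_const (c : ℂ) (g : G.carrier) : SmoothAt (fun _ => c) g :=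
  ⟨fun _ => c, contDiffAt_const, Filter.Eventually.of_forall fun _ => rfl⟩

theorem SmoothAt.add {u v : G.carrier → ℂ} {g : G.carrier} (hu : SmoothAt u g)
    (hv : SmoothAt v g) : SmoothAt (fun x => u x + v x) g := by
  obtain ⟨u', hu1, hu2⟩ := hu
  obtain ⟨v', hv1, hv2⟩ := hv
  exact ⟨_, hu1.add hv1, by filter_upwards [hu2, hv2] with x h1 h2; rw [h1, h2]⟩

theorem SmoothAt.mul {u v : G.carrier → ℂ} {g : G.carrier} (hu : SmoothAt u g)
    (hv : SmoothAt v g) : SmoothAt (fun x => u x * v x) g := by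
  obtain ⟨u', hu1, hu2⟩ := hu
  obtain ⟨v', hv1, hv2⟩ := hv
  exact ⟨_, hu1.mul hv1, by filter_upwards [hu2, hv2] with x h1 h2; rw [h1, h2]⟩

theorem SmoothAt.const_mul {u : G.carrier → ℂ} {g : G.carrier} (c : ℂ) (hu : SmoothAt u g) :
    SmoothAt (fun x => c * u x) g :=
  (smoothAt_const c g).mul hu

theorem SmoothAt.inv {u : G.carrier → ℂ} {g : G.carrier} (hu : SmoothAt u g) (h0 : u g ≠ 0) :
    SmoothAt (fun x => (u x)⁻¹) g := by
  obtain ⟨v, hv1, hv2⟩ := hu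
  exact ⟨fun M => (v M)⁻¹, hv1.inv (by rwa [← hv2.self_of_nhds]), by filter_upwards [hv2] with x h1; rw [h1]⟩

theorem SmoothAt.sum {κ : Type*} {s : Finset κ} {u : κ → G.carrier → ℂ} {g : G.carrier}
    (hu : ∀ k ∈ s, SmoothAt (u k) g) : SmoothAt (fun x => ∑ k ∈ s, u k x) g := by
  classical
  induction s using Finset.induction_on with
  | empty => simpa using smoothAt_const 0 g
  | insert a s ha ih =>
    simp only [Finset.sum_insert ha]
    exact (hu a (Finset.mem_insert_self a s)).add
      (ih fun k hk => hu k (Finset.mem_insert_of_mem hk))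

/-- The matrix coefficient `b ⬝ g c`. -/
def matCoeff (b c : ι → ℂ) (g : G.carrier) : ℂ := b ⬝ᵥ ((g : Matrix ι ι ℂ) *ᵥ c)

theorem matCoeff_eq_sum (b c : ι → ℂ) (g : G.carrier) :
    matCoeff b c g = ∑ i, ∑ j, b i * c j * (g : Matrix ι ι ℂ) i j := by
  simp only [matCoeff, dotProduct, Matrix.mulVec, Finset.mul_sum]
  exact Finset.sum_congr rfl fun i _ => Finset.sum_congr rfl fun j _ => by ring

theorem coeffComb_vecMulVec (b c : ι → ℂ) (g : G.carrier) :
    coeffComb G (Matrix.vecMulVec b c) g = matCoeff b c g := by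
  rw [matCoeff_eq_sum]
  rfl

theorem smoothAt_entry (i j : ι) (g : G.carrier) :
    SmoothAt (fun x : G.carrier => (x : Matrix ι ι ℂ) i j) g :=
  ⟨fun M => M i j, by fun_prop, Filter.Eventually.of_forall fun _ => rfl⟩

theorem smoothAt_matCoeff (b c : ι → ℂ) (g : G.carrier) :
    SmoothAt (G := G) (matCoeff b c) g := by
  have : (matCoeff b c : G.carrier → ℂ) =
      fun x : G.carrier => ∑ i, ∑ j, b i * c j * (x : Matrix ι ι ℂ) i j := funext (matCoeff_eq_sum b c)
  rw [this]
  exact SmoothAt.sum fun i _ => SmoothAt.sum fun j _ => (smoothAt_entry i j g).const_mul _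

theorem continuous_matCoeff (b c : ι → ℂ) : Continuous (matCoeff b c : G.carrier → ℂ) := by
  have : (matCoeff b c : G.carrier → ℂ) =
      fun x : G.carrier => ∑ i, ∑ j, b i * c j * (x : Matrix ι ι ℂ) i j := funext (matCoeff_eq_sum b c)
  rw [this]
  refine continuous_finsetSum _ fun i _ => continuous_finsetSum _ fun j _ => ?_
  exact continuous_const.mul (continuous_subtype_val.matrix_elem i j)

/-! ### Derivatives along left-invariant vector fields -/

theorem SmoothAt.contDiffAt {u : G.carrier → ℂ} {g : G.carrier} (hu : SmoothAt u g) (Z : G.lie) :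
    ContDiffAt ℝ 2 (fun s : ℝ => u (g * oneParam G Z s)) 0 := by
  obtain ⟨v, hv, he⟩ := hu
  have h1 : ContDiffAt ℝ ((⊤ : ℕ∞) : WithTop ℕ∞)
      (fun s : ℝ => v (fun i j => ((g * oneParam G Z s : G.carrier) : Matrix ι ι ℂ) i j)) 0 := by
    refine ContDiffAt.comp (0 : ℝ) ?_ (contDiff_mul_oneParam g Z).contDiffAt
    simpa only [oneParam_zero, mul_one] using hv
  exact (h1.congr_of_eventuallyEq ((tendsto_mul_oneParam g Z).eventually he)).of_le
    (by exact WithTop.coe_le_coe.2 le_top)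

theorem SmoothAt.differentiableAt {u : G.carrier → ℂ} {g : G.carrier} (hu : SmoothAt u g)
    (Z : G.lie) : DifferentiableAt ℝ (fun s : ℝ => u (g * oneParam G Z s)) 0 :=
  (hu.contDiffAt Z).differentiableAt (by norm_num)

theorem lieDeriv_add {u v : G.carrier → ℂ} {g : G.carrier} (hu : SmoothAt u g)
    (hv : SmoothAt v g) (Z : G.lie) :
    lieDeriv G Z (fun x => u x + v x) g = lieDeriv G Z u g + lieDeriv G Z v g :=
  deriv_fun_add (hu.differentiableAt Z) (hv.differentiableAt Z)

theorem lieDeriv_mul {u v : G.carrier → ℂ} {g : G.carrier} (hu : SmoothAt u g)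
    (hv : SmoothAt v g) (Z : G.lie) :
    lieDeriv G Z (fun x => u x * v x) g = lieDeriv G Z u g * v g + u g * lieDeriv G Z v g := by
  have := deriv_fun_mul (hu.differentiableAt Z) (hv.differentiableAt Z)
  simpa only [lieDeriv, oneParam_zero, mul_one] using this

theorem lieDeriv_const (c : ℂ) (g : G.carrier) (Z : G.lie) :
    lieDeriv G Z (fun _ => c) g = 0 :=
  deriv_const _ _

theorem lieDeriv2_const (c : ℂ) (g : G.carrier) (Z : G.lie) :
    lieDeriv2 G Z (fun _ => c) g = 0 := by
  simp [lieDeriv2, iteratedDeriv_succ, iteratedDeriv_zero]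

theorem lieDeriv2_add {u v : G.carrier → ℂ} {g : G.carrier} (hu : SmoothAt u g)
    (hv : SmoothAt v g) (Z : G.lie) :
    lieDeriv2 G Z (fun x => u x + v x) g = lieDeriv2 G Z u g + lieDeriv2 G Z v g :=
  iteratedDeriv_fun_add (hu.contDiffAt Z) (hv.contDiffAt Z)

theorem lieDeriv2_mul {u v : G.carrier → ℂ} {g : G.carrier} (hu : SmoothAt u g)
    (hv : SmoothAt v g) (Z : G.lie) :
    lieDeriv2 G Z (fun x => u x * v x) g = lieDeriv2 G Z u g * v g +
      2 * (lieDeriv G Z u g * lieDeriv G Z v g) + u g * lieDeriv2 G Z v g := by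
  have := iteratedDeriv_fun_mul (hu.contDiffAt Z) (hv.contDiffAt Z)
  simp only [Finset.sum_range_succ, Finset.sum_range_zero, iteratedDeriv_zero, iteratedDeriv_one,
    oneParam_zero, mul_one] at this
  simp only [lieDeriv2, lieDeriv, this]
  norm_num [oneParam_zero]
  ring

theorem lieDeriv_congr {u v : G.carrier → ℂ} {g : G.carrier} (h : u =ᶠ[nhds g] v) (Z : G.lie) :
    lieDeriv G Z u g = lieDeriv G Z v g :=
  Filter.EventuallyEq.deriv_eq ((tendsto_mul_oneParam g Z).eventually h)

theorem lieDeriv2_congr {u v : G.carrier → ℂ} {g : G.carrier} (h : u =ᶠ[nhds g] v) (Z : G.lie) :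
    lieDeriv2 G Z u g = lieDeriv2 G Z v g :=
  Filter.EventuallyEq.iteratedDeriv_eq 2 ((tendsto_mul_oneParam g Z).eventually h)

theorem hasDerivAt_matCoeff (b c : ι → ℂ) (g : G.carrier) (Z : G.lie) (s : ℝ) :
    HasDerivAt (fun s : ℝ => matCoeff b c (g * oneParam G Z s))
      (matCoeff b ((Z : Matrix ι ι ℂ) *ᵥ c) (g * oneParam G Z s)) s := by
  have h1 : ∀ (c : ι → ℂ) (s : ℝ), matCoeff b c (g * oneParam G Z s) =
      ∑ i, ∑ j, ((b ᵥ* (g : Matrix ι ι ℂ)) i * c j) *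
        NormedSpace.exp (s • (Z : Matrix ι ι ℂ)) i j := fun c s => by
    rw [matCoeff, coe_mul_oneParam, ← Matrix.mulVec_mulVec, Matrix.dotProduct_mulVec]
    simp only [dotProduct, Matrix.mulVec, Finset.mul_sum]
    exact Finset.sum_congr rfl fun i _ => Finset.sum_congr rfl fun j _ => by ring
  have h2 : matCoeff b ((Z : Matrix ι ι ℂ) *ᵥ c) (g * oneParam G Z s) =
      ∑ i, ∑ j, ((b ᵥ* (g : Matrix ι ι ℂ)) i * c j) *
        (NormedSpace.exp (s • (Z : Matrix ι ι ℂ)) * (Z : Matrix ι ι ℂ)) i j := by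
    rw [matCoeff, coe_mul_oneParam, Matrix.mulVec_mulVec, Matrix.mul_assoc, ← Matrix.mulVec_mulVec,
      Matrix.dotProduct_mulVec]
    simp only [dotProduct, Matrix.mulVec, Finset.mul_sum]
    exact Finset.sum_congr rfl fun i _ => Finset.sum_congr rfl fun j _ => by ring
  rw [h2]
  simp only [h1]
  exact HasDerivAt.fun_sum fun i _ => HasDerivAt.fun_sum fun j _ =>
    (hasDerivAt_exp_smul_apply _ s i j).const_mul _

theorem lieDeriv_matCoeff (b c : ι → ℂ) (g : G.carrier) (Z : G.lie) :
    lieDeriv G Z (matCoeff b c) g = matCoeff b ((Z : Matrix ι ι ℂ) *ᵥ c) g := by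
  have := (hasDerivAt_matCoeff b c g Z 0).deriv
  rwa [oneParam_zero, mul_one] at this

theorem lieDeriv2_matCoeff (b c : ι → ℂ) (g : G.carrier) (Z : G.lie) :
    lieDeriv2 G Z (matCoeff b c) g =
      matCoeff b ((Z : Matrix ι ι ℂ) *ᵥ ((Z : Matrix ι ι ℂ) *ᵥ c)) g := by
  have h : deriv (fun s : ℝ => matCoeff b c (g * oneParam G Z s)) =
      fun s : ℝ => matCoeff b ((Z : Matrix ι ι ℂ) *ᵥ c) (g * oneParam G Z s) :=
    funext fun s => (hasDerivAt_matCoeff b c g Z s).deriv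
  rw [lieDeriv2, iteratedDeriv_succ, iteratedDeriv_one, h]
  exact lieDeriv_matCoeff b _ g Z

/-! ### The tension field and the conformality operator -/

/-- The conformality operator: the complex bilinear extension of `⟨∇u, ∇v⟩`. -/
def conf (u v : G.carrier → ℂ) (g : G.carrier) : ℂ :=
  ∑ i, lieDeriv G (frame G i) u g * lieDeriv G (frame G i) v g

theorem conf_comm (u v : G.carrier → ℂ) (g : G.carrier) : conf u v g = conf v u g :=
  Finset.sum_congr rfl fun _ _ => mul_comm _ _

theorem conf_mul_left {u v : G.carrier → ℂ} {g : G.carrier} (hu : SmoothAt u g)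
    (hv : SmoothAt v g) (w : G.carrier → ℂ) :
    conf (fun x => u x * v x) w g = u g * conf v w g + v g * conf u w g := by
  simp only [conf, lieDeriv_mul hu hv, Finset.mul_sum, ← Finset.sum_add_distrib]
  exact Finset.sum_congr rfl fun _ _ => by ring

theorem conf_mul_right {u v : G.carrier → ℂ} {g : G.carrier} (hu : SmoothAt u g)
    (hv : SmoothAt v g) (w : G.carrier → ℂ) :
    conf w (fun x => u x * v x) g = u g * conf w v g + v g * conf w u g := by
  rw [conf_comm, conf_mul_left hu hv, conf_comm v, conf_comm u]

theorem conf_add_left {u v : G.carrier → ℂ} {g : G.carrier} (hu : SmoothAt u g)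
    (hv : SmoothAt v g) (w : G.carrier → ℂ) :
    conf (fun x => u x + v x) w g = conf u w g + conf v w g := by
  simp only [conf, lieDeriv_add hu hv, add_mul, Finset.sum_add_distrib]

theorem conf_add_right {u v : G.carrier → ℂ} {g : G.carrier} (hu : SmoothAt u g)
    (hv : SmoothAt v g) (w : G.carrier → ℂ) :
    conf w (fun x => u x + v x) g = conf w u g + conf w v g := by
  rw [conf_comm, conf_add_left hu hv, conf_comm v, conf_comm u]

theorem conf_const_left (c : ℂ) (w : G.carrier → ℂ) (g : G.carrier) :
    conf (fun _ => c) w g = 0 := by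
  simp [conf, lieDeriv_const]

theorem conf_const_right (c : ℂ) (w : G.carrier → ℂ) (g : G.carrier) :
    conf w (fun _ => c) g = 0 := by
  rw [conf_comm, conf_const_left]

theorem conf_congr {u u' v v' : G.carrier → ℂ} {g : G.carrier} (h : u =ᶠ[nhds g] u')
    (h' : v =ᶠ[nhds g] v') : conf u v g = conf u' v' g := by
  simp only [conf, lieDeriv_congr h, lieDeriv_congr h']

theorem tension_congr {u v : G.carrier → ℂ} {g : G.carrier} (h : u =ᶠ[nhds g] v) :
    tension G u g = tension G v g := by
  simp only [tension, lieDeriv_congr h, lieDeriv2_congr h]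

/-- For skew-Hermitian `Z` the pairing of `[W, Z]` with `Z` is `-tr([W, Z] Z)`, which vanishes by
cyclicity of the trace. One-parameter subgroups are therefore geodesics. -/
theorem nablaSelf_eq_zero (hG : ∀ Z ∈ G.lie, Zᴴ = -Z) (Z : G.lie) : nablaSelf G Z = 0 := by
  refine Finset.sum_eq_zero fun j _ => ?_
  have h : frob ((frame G j : Matrix ι ι ℂ) * (Z : Matrix ι ι ℂ) -
      (Z : Matrix ι ι ℂ) * (frame G j : Matrix ι ι ℂ)) Z = 0 := by
    rw [frob, hG _ Z.2, Matrix.mul_neg, Matrix.sub_mul, Matrix.trace_neg, Matrix.trace_sub,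
      Matrix.trace_mul_comm (_ * _) (Z : Matrix ι ι ℂ), Matrix.mul_assoc, sub_self, neg_zero,
      Complex.zero_re]
  rw [h, zero_smul]

theorem tension_eq_sum (hG : ∀ Z ∈ G.lie, Zᴴ = -Z) (u : G.carrier → ℂ) (g : G.carrier) :
    tension G u g = ∑ i, lieDeriv2 G (frame G i) u g := by
  have h0 : lieDeriv G 0 u g = 0 := by
    have : ∀ s, oneParam G 0 s = 1 := fun s => Subtype.ext (by simp [oneParam])
    simp [lieDeriv, this]
  simp only [tension, nablaSelf_eq_zero hG, h0, sub_zero]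

theorem tension_const (hG : ∀ Z ∈ G.lie, Zᴴ = -Z) (c : ℂ) (g : G.carrier) :
    tension G (fun _ => c) g = 0 := by
  simp [tension_eq_sum hG, lieDeriv2_const]

theorem tension_add (hG : ∀ Z ∈ G.lie, Zᴴ = -Z) {u v : G.carrier → ℂ} {g : G.carrier}
    (hu : SmoothAt u g) (hv : SmoothAt v g) :
    tension G (fun x => u x + v x) g = tension G u g + tension G v g := by
  simp only [tension_eq_sum hG, lieDeriv2_add hu hv, Finset.sum_add_distrib]

theorem tension_mul (hG : ∀ Z ∈ G.lie, Zᴴ = -Z) {u v : G.carrier → ℂ} {g : G.carrier}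
    (hu : SmoothAt u g) (hv : SmoothAt v g) :
    tension G (fun x => u x * v x) g =
      tension G u g * v g + 2 * conf u v g + u g * tension G v g := by
  simp only [tension_eq_sum hG, conf, lieDeriv2_mul hu hv, Finset.sum_add_distrib, Finset.sum_mul,
    Finset.mul_sum]

theorem tension_const_mul (hG : ∀ Z ∈ G.lie, Zᴴ = -Z) (c : ℂ) {u : G.carrier → ℂ}
    {g : G.carrier} (hu : SmoothAt u g) : tension G (fun x => c * u x) g = c * tension G u g := by
  rw [tension_mul hG (smoothAt_const c g) hu, tension_const hG, conf_const_left]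
  ring

theorem conf_const_mul_left (c : ℂ) {u : G.carrier → ℂ} {g : G.carrier} (hu : SmoothAt u g)
    (w : G.carrier → ℂ) : conf (fun x => c * u x) w g = c * conf u w g := by
  rw [conf_mul_left (smoothAt_const c g) hu, conf_const_left]
  ring

theorem tension_sum (hG : ∀ Z ∈ G.lie, Zᴴ = -Z) {κ : Type*} {s : Finset κ}
    {u : κ → G.carrier → ℂ} {g : G.carrier} (hu : ∀ k ∈ s, SmoothAt (u k) g) :
    tension G (fun x => ∑ k ∈ s, u k x) g = ∑ k ∈ s, tension G (u k) g := by
  classical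
  induction s using Finset.induction_on with
  | empty => simpa using tension_const hG 0 g
  | insert a s ha ih =>
    have hs : ∀ k ∈ s, SmoothAt (u k) g := fun k hk => hu k (Finset.mem_insert_of_mem hk)
    simp only [Finset.sum_insert ha]
    rw [tension_add hG (hu a (Finset.mem_insert_self a s)) (SmoothAt.sum hs), ih hs]

theorem continuous_coe_entries (G : MatrixLieGroup ι) :
    Continuous (fun (x : G.carrier) (i j : ι) => (x : Matrix ι ι ℂ) i j) :=
  continuous_subtype_val

theorem SmoothAt.eventually_ne {u : G.carrier → ℂ} {g : G.carrier} (hu : SmoothAt u g)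
    (h0 : u g ≠ 0) : ∀ᶠ x in nhds g, u x ≠ 0 := by
  obtain ⟨v, hv, he⟩ := hu
  have hc : ContinuousAt (fun x : G.carrier => v (fun i j => (x : Matrix ι ι ℂ) i j)) g :=
    ContinuousAt.comp (f := fun (x : G.carrier) (i j : ι) => (x : Matrix ι ι ℂ) i j)
      hv.continuousAt (continuous_coe_entries G).continuousAt
  have h1 : v (fun i j => (g : Matrix ι ι ℂ) i j) ≠ 0 := by rwa [← he.self_of_nhds]
  filter_upwards [hc.eventually_ne h1, he] with x h2 h3
  rwa [h3]

/-- Leibniz rule applied to `u * u⁻¹ = 1`. This identity holds only near `g`, where `u` stays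
nonzero, so locality of the operators is needed. -/
theorem conf_inv_left {u : G.carrier → ℂ} {g : G.carrier} (hu : SmoothAt u g) (h0 : u g ≠ 0)
    (w : G.carrier → ℂ) : conf (fun x => (u x)⁻¹) w g = -conf u w g / u g ^ 2 := by
  have h1 : conf (fun x => u x * (u x)⁻¹) w g = 0 := by
    rw [← conf_const_left 1 w g]
    refine conf_congr ?_ (Filter.EventuallyEq.refl _ _)
    filter_upwards [hu.eventually_ne h0] with x hx using mul_inv_cancel₀ hx
  rw [conf_mul_left hu (hu.inv h0)] at h1
  field_simp at h1 ⊢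
  linear_combination h1

theorem tension_inv (hG : ∀ Z ∈ G.lie, Zᴴ = -Z) {u : G.carrier → ℂ} {g : G.carrier}
    (hu : SmoothAt u g) (h0 : u g ≠ 0) :
    tension G (fun x => (u x)⁻¹) g = -tension G u g / u g ^ 2 + 2 * conf u u g / u g ^ 3 := by
  have h1 : tension G (fun x => u x * (u x)⁻¹) g = 0 := by
    rw [← tension_const hG 1 g]
    refine tension_congr ?_
    filter_upwards [hu.eventually_ne h0] with x hx using mul_inv_cancel₀ hx
  rw [tension_mul hG hu (hu.inv h0), conf_comm, conf_inv_left hu h0] at h1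
  field_simp at h1 ⊢
  linear_combination h1

/-! ### Quotients of matrix coefficients -/

/-- The Casimir relations satisfied by an orthonormal frame of the Lie algebra on the span of two
vectors `x` and `a`. -/
structure CasimirPair (G : MatrixLieGroup ι) (x a : ι → ℂ) (μ ν lam : ℂ) : Prop where
  skew : ∀ Z ∈ G.lie, Zᴴ = -Z
  sum_sq : ∀ c : ι → ℂ, ∑ i, (frame G i : Matrix ι ι ℂ) *ᵥ ((frame G i : Matrix ι ι ℂ) *ᵥ c) =
    lam • c
  sum_mul : ∀ c ∈ ({x, a} : Set (ι → ℂ)), ∀ c' ∈ ({x, a} : Set (ι → ℂ)), ∀ b b' : ι → ℂ,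
    ∑ i, (b ⬝ᵥ ((frame G i : Matrix ι ι ℂ) *ᵥ c)) * (b' ⬝ᵥ ((frame G i : Matrix ι ι ℂ) *ᵥ c')) =
      -μ * ((b ⬝ᵥ c') * (b' ⬝ᵥ c)) + ν * ((b ⬝ᵥ c) * (b' ⬝ᵥ c'))

namespace CasimirPair

variable {x a : ι → ℂ} {μ ν lam : ℂ}

theorem conf_matCoeff (H : CasimirPair G x a μ ν lam) {c c' : ι → ℂ}
    (hc : c ∈ ({x, a} : Set (ι → ℂ))) (hc' : c' ∈ ({x, a} : Set (ι → ℂ))) (b b' : ι → ℂ)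
    (g : G.carrier) :
    conf (matCoeff b c) (matCoeff b' c') g =
      -μ * (matCoeff b c' g * matCoeff b' c g) + ν * (matCoeff b c g * matCoeff b' c' g) := by
  have h := H.sum_mul c hc c' hc' (b ᵥ* (g : Matrix ι ι ℂ)) (b' ᵥ* (g : Matrix ι ι ℂ))
  simpa only [conf, lieDeriv_matCoeff, matCoeff, Matrix.dotProduct_mulVec] using h

theorem tension_matCoeff (H : CasimirPair G x a μ ν lam) (b c : ι → ℂ) (g : G.carrier) :
    tension G (matCoeff b c) g = lam * matCoeff b c g := by
  rw [tension_eq_sum H.skew]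
  have h := congrArg (fun z => (b ᵥ* (g : Matrix ι ι ℂ)) ⬝ᵥ z) (H.sum_sq c)
  simpa only [lieDeriv2_matCoeff, matCoeff, dotProduct_sum, dotProduct_smul, smul_eq_mul,
    Matrix.dotProduct_mulVec] using h

end CasimirPair

/-- The quotient `(b ⬝ g c) / (y ⬝ g x)`. -/
def quotCoeff (y x b c : ι → ℂ) (g : G.carrier) : ℂ := matCoeff b c g * (matCoeff y x g)⁻¹

theorem smoothAt_quotCoeff {y x : ι → ℂ} {g : G.carrier} (h0 : matCoeff y x g ≠ 0)
    (b c : ι → ℂ) : SmoothAt (G := G) (quotCoeff y x b c) g :=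
  (smoothAt_matCoeff b c g).mul ((smoothAt_matCoeff y x g).inv h0)

theorem quotCoeff_self {y x : ι → ℂ} {g : G.carrier} (h0 : matCoeff y x g ≠ 0) :
    quotCoeff y x y x g = 1 :=
  mul_inv_cancel₀ h0

/-- The function `-2μ (v_b u_y - u_b v_y) / u_y²`, where `u_b = b ⬝ g x` and `v_b = b ⬝ g a`; it is
the tension field of `v_b / u_y`. -/
def minorQuot (μ : ℂ) (y x a b : ι → ℂ) (g : G.carrier) : ℂ :=
  -2 * μ * (quotCoeff y x b a g + -1 * (quotCoeff y x b x g * quotCoeff y x y a g))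

theorem smoothAt_minorQuot {y x : ι → ℂ} {g : G.carrier} (h0 : matCoeff y x g ≠ 0)
    (μ : ℂ) (a b : ι → ℂ) : SmoothAt (G := G) (minorQuot μ y x a b) g :=
  ((smoothAt_quotCoeff h0 b a).add
    (((smoothAt_quotCoeff h0 b x).mul (smoothAt_quotCoeff h0 y a)).const_mul _)).const_mul _

theorem conf_quot_left {u q : G.carrier → ℂ} {g : G.carrier} (hu : SmoothAt u g)
    (hq : SmoothAt q g) (h0 : q g ≠ 0) (w : G.carrier → ℂ) :
    conf (fun z => u z * (q z)⁻¹) w g = conf u w g / q g - u g * conf q w g / q g ^ 2 := by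
  rw [conf_mul_left hu (hq.inv h0), conf_inv_left hq h0]
  field_simp
  ring

theorem tension_quot (hG : ∀ Z ∈ G.lie, Zᴴ = -Z) {u q : G.carrier → ℂ} {g : G.carrier}
    (hu : SmoothAt u g) (hq : SmoothAt q g) (h0 : q g ≠ 0) :
    tension G (fun z => u z * (q z)⁻¹) g = tension G u g / q g - 2 * conf u q g / q g ^ 2 -
      u g * tension G q g / q g ^ 2 + 2 * u g * conf q q g / q g ^ 3 := by
  rw [tension_mul hG hu (hq.inv h0), conf_comm, conf_inv_left hq h0, tension_inv hG hq h0,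
    conf_comm q u]
  field_simp
  ring

namespace CasimirPair

variable {x a : ι → ℂ} {μ ν lam : ℂ}

/-- Expanding both quotients gives four terms with signs `+, -, -, +`. The `ν`-part of `κ`
contributes the same product to each of them and drops out, so only the swap part survives. -/
theorem conf_quotCoeff (H : CasimirPair G x a μ ν lam) {c c' : ι → ℂ}
    (hc : c ∈ ({x, a} : Set (ι → ℂ))) (hc' : c' ∈ ({x, a} : Set (ι → ℂ))) (y b b' : ι → ℂ)
    {g : G.carrier} (h0 : matCoeff y x g ≠ 0) :
    conf (quotCoeff y x b c) (quotCoeff y x b' c') g =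
      -μ * (quotCoeff y x b c' g * quotCoeff y x b' c g -
        quotCoeff y x b' c' g * quotCoeff y x b x g * quotCoeff y x y c g -
        quotCoeff y x b c g * quotCoeff y x y c' g * quotCoeff y x b' x g +
        quotCoeff y x b c g * quotCoeff y x b' c' g) := by
  have hx : x ∈ ({x, a} : Set (ι → ℂ)) := by simp
  have hS : ∀ b c, SmoothAt (G := G) (matCoeff b c) g := fun b c => smoothAt_matCoeff b c g
  change conf (fun z => matCoeff b c z * (matCoeff y x z)⁻¹)
    (fun z => matCoeff b' c' z * (matCoeff y x z)⁻¹) g = _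
  rw [conf_quot_left (hS _ _) (hS _ _) h0, conf_comm (matCoeff b c), conf_comm (matCoeff y x),
    conf_quot_left (hS _ _) (hS _ _) h0, conf_quot_left (hS _ _) (hS _ _) h0,
    H.conf_matCoeff hc' hc, H.conf_matCoeff hx hc, H.conf_matCoeff hc' hx, H.conf_matCoeff hx hx]
  simp only [quotCoeff]
  field_simp
  ring

/-- Numerator and denominator have the same eigenvalue `lam`, so these terms cancel, as does the
`ν`-part; what remains is the swap term of `κ`. -/
theorem tension_quotCoeff (H : CasimirPair G x a μ ν lam) {c : ι → ℂ}
    (hc : c ∈ ({x, a} : Set (ι → ℂ))) (y b : ι → ℂ) {g : G.carrier} (h0 : matCoeff y x g ≠ 0) :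
    tension G (quotCoeff y x b c) g =
      -2 * μ * (quotCoeff y x b c g - quotCoeff y x b x g * quotCoeff y x y c g) := by
  have hx : x ∈ ({x, a} : Set (ι → ℂ)) := by simp
  have hS : ∀ b c, SmoothAt (G := G) (matCoeff b c) g := fun b c => smoothAt_matCoeff b c g
  change tension G (fun z => matCoeff b c z * (matCoeff y x z)⁻¹) g = _
  rw [tension_quot H.skew (hS _ _) (hS _ _) h0, H.tension_matCoeff, H.tension_matCoeff,
    H.conf_matCoeff hc hx, H.conf_matCoeff hx hx]
  simp only [quotCoeff]
  field_simp
  ring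

theorem conf_minorQuot_left (y b : ι → ℂ) {g : G.carrier} (h0 : matCoeff y x g ≠ 0)
    (w : G.carrier → ℂ) : conf (minorQuot μ y x a b) w g =
      -2 * μ * (conf (quotCoeff y x b a) w g - (quotCoeff y x b x g * conf (quotCoeff y x y a) w g +
        quotCoeff y x y a g * conf (quotCoeff y x b x) w g)) := by
  have hS : ∀ b c, SmoothAt (G := G) (quotCoeff y x b c) g := smoothAt_quotCoeff h0
  have hP := (hS b x).mul (hS y a)
  change conf (fun z => -2 * μ * (quotCoeff y x b a z +
    -1 * (quotCoeff y x b x z * quotCoeff y x y a z))) w g = _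
  rw [conf_const_mul_left _ ((hS b a).add (hP.const_mul _)), conf_add_left (hS b a) (hP.const_mul _),
    conf_const_mul_left _ hP, conf_mul_left (hS b x) (hS y a)]
  ring

theorem conf_minorQuot_quotCoeff_x (H : CasimirPair G x a μ ν lam) (y b b' : ι → ℂ)
    {g : G.carrier} (h0 : matCoeff y x g ≠ 0) :
    conf (minorQuot μ y x a b) (quotCoeff y x b' x) g = 0 := by
  have hx : x ∈ ({x, a} : Set (ι → ℂ)) := by simp
  have ha : a ∈ ({x, a} : Set (ι → ℂ)) := by simp
  rw [conf_minorQuot_left y b h0, H.conf_quotCoeff ha hx y _ _ h0, H.conf_quotCoeff ha hx y _ _ h0,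
    H.conf_quotCoeff hx hx y _ _ h0, quotCoeff_self h0]
  ring

theorem conf_minorQuot_quotCoeff_a (H : CasimirPair G x a μ ν lam) (y b b' : ι → ℂ)
    {g : G.carrier} (h0 : matCoeff y x g ≠ 0) :
    conf (minorQuot μ y x a b) (quotCoeff y x b' a) g =
      minorQuot μ y x a b g * minorQuot μ y x a b' g := by
  have hx : x ∈ ({x, a} : Set (ι → ℂ)) := by simp
  have ha : a ∈ ({x, a} : Set (ι → ℂ)) := by simp
  rw [conf_minorQuot_left y b h0, H.conf_quotCoeff ha ha y _ _ h0, H.conf_quotCoeff ha ha y _ _ h0,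
    H.conf_quotCoeff hx ha y _ _ h0, quotCoeff_self h0, minorQuot, minorQuot]
  ring

theorem conf_minorQuot_minorQuot (H : CasimirPair G x a μ ν lam) (y b b' : ι → ℂ)
    {g : G.carrier} (h0 : matCoeff y x g ≠ 0) :
    conf (minorQuot μ y x a b) (minorQuot μ y x a b') g =
      -2 * μ * (minorQuot μ y x a b g * minorQuot μ y x a b' g) := by
  -- For `b = y` the minor degenerates. Hence `v_y / u_y` has no `κ`-pairing with `minorQuot`, and
  -- neither has `u_b' / u_y`; only the `v_b' / u_y` summand contributes.
  have hy : minorQuot (G := G) μ y x a y g = 0 := by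
    rw [minorQuot, quotCoeff_self h0]
    ring
  rw [conf_comm, conf_minorQuot_left y b' h0, conf_comm, H.conf_minorQuot_quotCoeff_a y _ _ h0,
    conf_comm, H.conf_minorQuot_quotCoeff_a y _ _ h0, conf_comm,
    H.conf_minorQuot_quotCoeff_x y _ _ h0, hy]
  ring

theorem tension_minorQuot (H : CasimirPair G x a μ ν lam) (y b : ι → ℂ)
    {g : G.carrier} (h0 : matCoeff y x g ≠ 0) : tension G (minorQuot μ y x a b) g = 0 := by
  have hx : x ∈ ({x, a} : Set (ι → ℂ)) := by simp
  have ha : a ∈ ({x, a} : Set (ι → ℂ)) := by simp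
  have hS : ∀ b c, SmoothAt (G := G) (quotCoeff y x b c) g := smoothAt_quotCoeff h0
  have hP := (hS b x).mul (hS y a)
  change tension G (fun z => -2 * μ * (quotCoeff y x b a z +
    -1 * (quotCoeff y x b x z * quotCoeff y x y a z))) g = _
  rw [tension_const_mul H.skew _ ((hS b a).add (hP.const_mul _)),
    tension_add H.skew (hS b a) (hP.const_mul _), tension_const_mul H.skew _ hP,
    tension_mul H.skew (hS b x) (hS y a), H.tension_quotCoeff ha y _ h0,
    H.tension_quotCoeff hx y _ h0, H.tension_quotCoeff ha y _ h0, H.conf_quotCoeff hx ha y _ _ h0,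
    quotCoeff_self h0]
  ring

end CasimirPair

/-! ### Families closed under the tension field and the conformality operator -/

/-- A family of functions `f`, with tension fields `h`, on whose homogeneous polynomials the tension
field acts by explicit first order operators. -/
structure BiharmonicFamily {κ : Type*} (W : Set G.carrier) (f h : κ → G.carrier → ℂ) (μ : ℂ) :
    Prop where
  skew : ∀ Z ∈ G.lie, Zᴴ = -Z
  smooth_f : ∀ i, ∀ g ∈ W, SmoothAt (f i) g
  smooth_h : ∀ i, ∀ g ∈ W, SmoothAt (h i) g
  tension_f : ∀ i, ∀ g ∈ W, tension G (f i) g = h i g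
  tension_h : ∀ i, ∀ g ∈ W, tension G (h i) g = 0
  conf_ff : ∀ i j, ∀ g ∈ W, conf (f i) (f j) g = 1 / 2 * (f i g * h j g + h i g * f j g)
  conf_fh : ∀ i j, ∀ g ∈ W, conf (f i) (h j) g = h i g * h j g
  conf_hh : ∀ i j, ∀ g ∈ W, conf (h i) (h j) g = -2 * μ * (h i g * h j g)

theorem CasimirPair.biharmonicFamily {x a : ι → ℂ} {μ ν lam : ℂ} {κ : Type*}
    (H : CasimirPair G x a μ ν lam) (y : ι → ℂ) (b : κ → ι → ℂ) :
    BiharmonicFamily {g : G.carrier | matCoeff y x g ≠ 0} (fun i => quotCoeff y x (b i) a)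
      (fun i => minorQuot μ y x a (b i)) μ where
  skew := H.skew
  smooth_f _ _ hg := smoothAt_quotCoeff hg _ _
  smooth_h _ _ hg := smoothAt_minorQuot hg _ _ _
  tension_f i g hg := by
    rw [H.tension_quotCoeff (by simp) y _ hg, minorQuot]
    ring
  tension_h _ _ hg := H.tension_minorQuot y _ hg
  conf_ff i j g hg := by
    rw [H.conf_quotCoeff (by simp) (by simp) y _ _ hg, minorQuot, minorQuot]
    ring
  conf_fh i j g hg := by
    rw [conf_comm, H.conf_minorQuot_quotCoeff_a y _ _ hg, mul_comm]
  conf_hh i j g hg := H.conf_minorQuot_minorQuot y _ _ hg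

open Polynomial in
/-- The coefficient of `X ^ b` in the product of the polynomials `f_i + h_i X`, `i ∈ s`. -/
def mixedProd {κ : Type*} (f h : κ → G.carrier → ℂ) (s : Multiset κ) (b : ℕ) (g : G.carrier) : ℂ :=
  ((s.map fun i => C (f i g) + X * C (h i g)).prod).coeff b

section mixedProd

variable {κ : Type*} {f h : κ → G.carrier → ℂ}

theorem mixedProd_zero (b : ℕ) :
    mixedProd f h 0 b = fun _ => if b = 0 then (1 : ℂ) else 0 := by
  funext g
  simp [mixedProd, Polynomial.coeff_one]

theorem mixedProd_cons_zero (i : κ) (s : Multiset κ) :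
    mixedProd f h (i ::ₘ s) 0 = fun g => f i g * mixedProd f h s 0 g := by
  funext g
  simp [mixedProd]

theorem mixedProd_cons_succ (i : κ) (s : Multiset κ) (b : ℕ) :
    mixedProd f h (i ::ₘ s) (b + 1) =
      fun g => f i g * mixedProd f h s (b + 1) g + h i g * mixedProd f h s b g := by
  funext g
  simp [mixedProd, add_mul, mul_assoc, Polynomial.coeff_X_mul]

theorem mixedProd_of_card_lt (s : Multiset κ) {b : ℕ} (hb : s.card < b) (g : G.carrier) :
    mixedProd f h s b g = 0 := by
  induction s using Multiset.induction_on generalizing b with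
  | empty => simp [mixedProd_zero, (Nat.ne_of_gt hb : b ≠ 0)]
  | cons i s ih =>
    rw [Multiset.card_cons] at hb
    obtain ⟨b, rfl⟩ : ∃ b', b = b' + 1 := ⟨b - 1, by omega⟩
    rw [mixedProd_cons_succ]
    simp [ih (show s.card < b + 1 by omega), ih (show s.card < b by omega)]

theorem mixedProd_of_f_eq_zero {g : G.carrier} (hf : ∀ i, f i g = 0) (s : Multiset κ) (b : ℕ) :
    mixedProd f h s b g = if b = s.card then (s.map fun i => h i g).prod else 0 := by
  induction s using Multiset.induction_on generalizing b with
  | empty => by_cases hb : b = 0 <;> simp [mixedProd_zero, hb]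
  | cons i s ih =>
    rcases b with _ | b
    · simp [mixedProd_cons_zero, hf]
    · simp [mixedProd_cons_succ, hf, ih, mul_ite]

variable {W : Set G.carrier} {μ : ℂ}

theorem BiharmonicFamily.smoothAt_mixedProd (H : BiharmonicFamily W f h μ) (s : Multiset κ) (b : ℕ)
    {g : G.carrier} (hg : g ∈ W) : SmoothAt (mixedProd f h s b) g := by
  induction s using Multiset.induction_on generalizing b with
  | empty => rw [mixedProd_zero]; exact smoothAt_const _ g
  | cons i s ih =>
    rcases b with _ | b
    · rw [mixedProd_cons_zero]
      exact (H.smooth_f i g hg).mul (ih 0)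
    · rw [mixedProd_cons_succ]
      exact ((H.smooth_f i g hg).mul (ih _)).add ((H.smooth_h i g hg).mul (ih _))

/-- The derivation `κ(h_j, ·)` sends `f_i + h_i X` to `h_j (1 - 2μX) h_i`, and `h_i` is the
`X`-derivative of that factor. On the product `P` it therefore acts as `h_j (1 - 2μX) d/dX`; the
formula compares coefficients. -/
theorem BiharmonicFamily.conf_h_mixedProd (H : BiharmonicFamily W f h μ) (j : κ) (s : Multiset κ)
    (b : ℕ) {g : G.carrier} (hg : g ∈ W) :
    conf (h j) (mixedProd f h s b) g =
      h j g * ((b + 1) * mixedProd f h s (b + 1) g - 2 * μ * b * mixedProd f h s b g) := by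
  induction s using Multiset.induction_on generalizing b with
  | empty =>
    rw [mixedProd_zero, conf_const_right, mixedProd_zero]
    rcases b with _ | b <;> simp
  | cons i s ih =>
    have hS := fun b => H.smoothAt_mixedProd s b hg
    have hf := H.smooth_f i g hg
    have hh := H.smooth_h i g hg
    rcases b with _ | b
    · rw [mixedProd_cons_zero, conf_mul_right hf (hS 0), ih, conf_comm, H.conf_fh i j g hg,
        mixedProd_cons_succ]
      push_cast
      ring
    · rw [mixedProd_cons_succ, conf_add_right (hf.mul (hS _)) (hh.mul (hS _)),
        conf_mul_right hf (hS _), conf_mul_right hh (hS _), ih, ih, conf_comm (h j) (f i),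
        H.conf_fh i j g hg, H.conf_hh j i g hg, mixedProd_cons_succ]
      push_cast
      ring

/-- The derivation `κ(f_j, ·)` sends `p_i = f_i + h_i X` to `(h_j p_i + p_j h_i) / 2`. On a product
`P` of `δ` factors it gives `(δ h_j P + p_j P') / 2`. -/
theorem BiharmonicFamily.conf_f_mixedProd (H : BiharmonicFamily W f h μ) (j : κ) (s : Multiset κ)
    (b : ℕ) {g : G.carrier} (hg : g ∈ W) :
    conf (f j) (mixedProd f h s b) g =
      1 / 2 * ((s.card + b) * (h j g * mixedProd f h s b g) +
        (b + 1) * (f j g * mixedProd f h s (b + 1) g)) := by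
  induction s using Multiset.induction_on generalizing b with
  | empty =>
    rw [mixedProd_zero, conf_const_right, mixedProd_zero]
    rcases b with _ | b <;> simp
  | cons i s ih =>
    have hS := fun b => H.smoothAt_mixedProd s b hg
    have hf := H.smooth_f i g hg
    have hh := H.smooth_h i g hg
    rw [Multiset.card_cons]
    rcases b with _ | b
    · rw [mixedProd_cons_zero, conf_mul_right hf (hS 0), ih, H.conf_ff j i g hg,
        mixedProd_cons_succ]
      push_cast
      ring
    · rw [mixedProd_cons_succ, conf_add_right (hf.mul (hS _)) (hh.mul (hS _)),
        conf_mul_right hf (hS _), conf_mul_right hh (hS _), ih, ih,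
        H.conf_ff j i g hg, H.conf_fh j i g hg, mixedProd_cons_succ]
      push_cast
      ring

/-- Coefficient form of `τ P = δ P' + X (1 - 2μX) P''`. The factors `τ(f_i) = h_i` give one `P'`,
and the pairings `κ(p_i, p_j) = (p_i h_j + h_i p_j) / 2 + X (1 - 2μX) h_i h_j` give `(δ - 1) P'` and
the second-order term. -/
theorem BiharmonicFamily.tension_mixedProd (H : BiharmonicFamily W f h μ) (s : Multiset κ)
    (b : ℕ) {g : G.carrier} (hg : g ∈ W) :
    tension G (mixedProd f h s b) g =
      (s.card + b) * (b + 1) * mixedProd f h s (b + 1) g -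
        2 * μ * (b * (b - 1)) * mixedProd f h s b g := by
  induction s using Multiset.induction_on generalizing b with
  | empty =>
    rw [mixedProd_zero, tension_const H.skew, mixedProd_zero]
    rcases b with _ | b <;> simp
  | cons i s ih =>
    have hS := fun b => H.smoothAt_mixedProd s b hg
    have hf := H.smooth_f i g hg
    have hh := H.smooth_h i g hg
    rw [Multiset.card_cons]
    rcases b with _ | b
    · rw [mixedProd_cons_zero, tension_mul H.skew hf (hS 0), ih, H.tension_f i g hg,
        H.conf_f_mixedProd i s 0 hg, mixedProd_cons_succ]
      push_cast
      ring
    · rw [mixedProd_cons_succ, tension_add H.skew (hf.mul (hS _)) (hh.mul (hS _)),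
        tension_mul H.skew hf (hS _), tension_mul H.skew hh (hS _), ih, ih, H.tension_f i g hg,
        H.tension_h i g hg, H.conf_f_mixedProd i s _ hg, H.conf_h_mixedProd i s _ hg,
        mixedProd_cons_succ]
      push_cast
      ring

end mixedProd

/-! ### The coefficients of the biharmonic polynomial -/

/-- The action of the tension field on the coefficients of `∑ v_b φ_b`, where `φ_b` is the
mixed product of degree `b` of `δ` factors. -/
def coeffStep (μ : ℂ) (δ : ℕ) (v : ℕ → ℂ) : ℕ → ℂ
  | 0 => 0
  | b + 1 => (δ + b) * (b + 1) * v b - 2 * μ * ((b + 1) * b) * v (b + 1)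

theorem BiharmonicFamily.tension_sum_mixedProd {κ : Type*} {f h : κ → G.carrier → ℂ}
    {W : Set G.carrier} {μ : ℂ} (H : BiharmonicFamily W f h μ) (s : Multiset κ) (v : ℕ → ℂ)
    {g : G.carrier} (hg : g ∈ W) :
    tension G (fun x => ∑ b ∈ Finset.range (s.card + 1), v b * mixedProd f h s b x) g =
      ∑ b ∈ Finset.range (s.card + 1), coeffStep μ s.card v b * mixedProd f h s b g := by
  have hS := fun b => H.smoothAt_mixedProd s b hg
  rw [tension_sum H.skew fun b _ => (hS b).const_mul _]
  simp only [tension_const_mul H.skew _ (hS _), H.tension_mixedProd s _ hg]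
  rw [Finset.sum_range_succ' (fun b => coeffStep μ s.card v b * mixedProd f h s b g)]
  have h1 : ∀ b : ℕ, v b * ((s.card + b) * (b + 1) * mixedProd f h s (b + 1) g -
      2 * μ * (b * (b - 1)) * mixedProd f h s b g) =
      (s.card + b) * (b + 1) * v b * mixedProd f h s (b + 1) g -
        2 * μ * (b * (b - 1)) * v b * mixedProd f h s b g := fun b => by ring
  have h2 : ∀ b : ℕ, coeffStep μ s.card v (b + 1) * mixedProd f h s (b + 1) g =
      (s.card + b) * (b + 1) * v b * mixedProd f h s (b + 1) g -
        2 * μ * (((b + 1 : ℕ) : ℂ) * (((b + 1 : ℕ) : ℂ) - 1)) * v (b + 1) *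
          mixedProd f h s (b + 1) g := fun b => by
    rw [coeffStep]
    push_cast
    ring
  simp only [h1, h2, Finset.sum_sub_distrib]
  -- The shifted sum loses its top term because `P` has degree at most `δ`, so `φ_{δ+1} = 0`; the
  -- diagonal sum loses its bottom term because of the factor `b`.
  rw [Finset.sum_range_succ, Finset.sum_range_succ' (fun b : ℕ => 2 * μ * _ * v b * _),
    mixedProd_of_card_lt s (Nat.lt_succ_self _)]
  simp [coeffStep]

/-- The diagonal `-2μ b (b - 1)` of `coeffStep` vanishes only at `b = 0, 1`, and the link from `0`
to `1` is `δ ≠ 0`. So a vector of the kernel of the square can start with `v 0 = 1`. Its image is a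
kernel vector supported in degrees at least one, all of whose entries there are nonzero. -/
theorem exists_coeffStep {μ : ℂ} (hμ : μ ≠ 0) {δ : ℕ} (hδ : δ ≠ 0) :
    ∃ v : ℕ → ℂ, v 0 ≠ 0 ∧ (∀ b, coeffStep μ δ (coeffStep μ δ v) b = 0) ∧
      ∀ b, coeffStep μ δ v (b + 1) ≠ 0 := by
  -- `w b` is the entry of the image in degree `b + 1`. The start `δ` is forced by `v 0 = 1`, the
  -- recursion by membership in the kernel.
  let w : ℕ → ℂ := fun b => Nat.rec (δ : ℂ)
    (fun b w => (δ + (b + 1)) / (2 * μ * (b + 1)) * w) b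
  have hw : ∀ b : ℕ, w (b + 1) = (δ + (b + 1)) / (2 * μ * (b + 1)) * w b := fun b => rfl
  have hb : ∀ b : ℕ, (b : ℂ) + 1 ≠ 0 := fun b => by exact_mod_cast b.succ_ne_zero
  have hd : ∀ b : ℕ, (δ : ℂ) + (b + 1) ≠ 0 := fun b => by
    exact_mod_cast (show δ + (b + 1) ≠ 0 by omega)
  have hw0 : ∀ b, w b ≠ 0 := fun b => by
    induction b with
    | zero => exact Nat.cast_ne_zero.2 hδ
    | succ b ih =>
      rw [hw]
      exact mul_ne_zero (div_ne_zero (hd b) (mul_ne_zero (mul_ne_zero two_ne_zero hμ) (hb b))) ih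
  -- Solve `coeffStep μ δ v (b + 1) = w b` for `v (b + 1)`. At `b = 0` the coefficient of `v 1` is
  -- zero, so `v 1` is free and is set to `0`.
  let v : ℕ → ℂ := fun b => Nat.rec (1 : ℂ) (fun b v => if b = 0 then 0 else
    ((δ + b) * (b + 1) * v - w b) / (2 * μ * ((b + 1) * b))) b
  have hv : ∀ b : ℕ, v (b + 1) = if b = 0 then 0 else
    ((δ + b) * (b + 1) * v b - w b) / (2 * μ * ((b + 1) * b)) := fun b => rfl
  have hT : ∀ b : ℕ, coeffStep μ δ v (b + 1) = w b := fun b => by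
    rcases b with _ | b
    · have h0 : v 0 = 1 := rfl
      have h1 : w 0 = δ := rfl
      simp [coeffStep, h0, h1]
    · rw [coeffStep, hv (b + 1), if_neg b.succ_ne_zero]
      have h1 := hb b
      have h2 := hb (b + 1)
      push_cast at h1 h2 ⊢
      field_simp
      ring
  refine ⟨v, one_ne_zero, fun b => ?_, fun b => by rw [hT]; exact hw0 b⟩
  rcases b with _ | _ | b
  · rfl
  · simp [coeffStep]
  · rw [coeffStep, hT, hT, hw]
    have h1 := hb b
    push_cast
    field_simp
    ring

/-! ### Biharmonic polynomials -/

/-- Binomial expansion of `∏ (f_i + h_i X) ^ d_i`: collecting powers of `X` leaves a weight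
depending on `k` only through `∑ k_i`, times binomial coefficients. -/
theorem prod_pow_eq_sum_Iic {m : ℕ} (d : Fin m → ℕ) (f h : Fin m → ℂ) (v : ℕ → ℂ) (N : ℕ)
    (hN : ∑ i, d i < N) :
    ∑ b ∈ Finset.range N, v b * ((((∑ i, d i • ({i} : Multiset (Fin m))).map fun i =>
        Polynomial.C (f i) + Polynomial.X * Polynomial.C (h i)).prod).coeff b) =
      ∑ k ∈ Finset.Iic d, v (∑ i, k i) * (∏ i, ((d i).choose (k i) : ℂ)) *
        ∏ i, (f i ^ (d i - k i) * h i ^ k i) := by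
  have h1 : ((∑ i, d i • ({i} : Multiset (Fin m))).map fun i =>
      Polynomial.C (f i) + Polynomial.X * Polynomial.C (h i)).prod =
      ∏ i, (Polynomial.X * Polynomial.C (h i) + Polynomial.C (f i)) ^ d i := by
    rw [← Multiset.coe_mapAddMonoidHom, map_sum, Multiset.prod_sum]
    refine Finset.prod_congr rfl fun i _ => ?_
    rw [map_nsmul, Multiset.prod_nsmul, Multiset.coe_mapAddMonoidHom, Multiset.map_singleton,
      Multiset.prod_singleton, add_comm]
  have h2 : Fintype.piFinset (fun i => Finset.range (d i + 1)) = Finset.Iic d := by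
    ext k
    simp [Pi.le_def]
  have h3 : ∏ i, (Polynomial.X * Polynomial.C (h i) + Polynomial.C (f i)) ^ d i =
      ∑ k ∈ Finset.Iic d, Polynomial.C ((∏ i, ((d i).choose (k i) : ℂ)) *
        ∏ i, (f i ^ (d i - k i) * h i ^ k i)) * Polynomial.X ^ (∑ i, k i) := by
    simp only [add_pow]
    rw [Finset.prod_univ_sum, h2]
    refine Finset.sum_congr rfl fun k _ => ?_
    rw [← Finset.prod_mul_distrib, map_prod, ← Finset.prod_pow_eq_pow_sum,
      ← Finset.prod_mul_distrib]
    refine Finset.prod_congr rfl fun i _ => ?_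
    simp only [mul_pow, map_mul, map_pow, map_natCast]
    ring
  rw [h1, h3]
  simp only [Polynomial.finsetSum_coeff, Polynomial.coeff_C_mul, Polynomial.coeff_X_pow,
    Finset.mul_sum]
  rw [Finset.sum_comm]
  refine Finset.sum_congr rfl fun k hk => ?_
  rw [Finset.sum_eq_single (∑ i, k i)]
  · rw [if_pos rfl]
    ring
  · intro b _ hb
    rw [if_neg hb]
    ring
  · intro hb
    refine absurd (Finset.mem_range.2 (lt_of_le_of_lt ?_ hN)) hb
    exact Finset.sum_le_sum fun i _ => Finset.mem_Iic.1 hk i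

/-- The multi-homogeneous polynomials of a family of functions that is closed under the tension
field contain a proper biharmonic function. -/
theorem BiharmonicFamily.exists_multiPoly {m : ℕ} {f h : Fin m → G.carrier → ℂ}
    {W : Set G.carrier} {μ : ℂ} (H : BiharmonicFamily W f h μ) (hμ : μ ≠ 0) (hW : IsOpen W)
    {d : Fin m → ℕ} (hd : d ≠ 0) {g₀ : G.carrier} (hg₀ : g₀ ∈ W) (hf₀ : ∀ i, f i g₀ = 0)
    (hh₀ : ∀ i, h i g₀ ≠ 0) :
    ∃ c : (Fin m → ℕ) → ℂ, c 0 ≠ 0 ∧ IsProperBiharmonicOn G W (multiPoly G d c f) := by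
  set s : Multiset (Fin m) := ∑ i, d i • ({i} : Multiset (Fin m)) with hs
  have hcard : s.card = ∑ i, d i := by simp [hs]
  have hδ : s.card ≠ 0 := by
    rw [hcard]
    intro h0
    exact hd (funext fun i => Finset.sum_eq_zero_iff.1 h0 i (Finset.mem_univ i))
  obtain ⟨v, hv0, hv1, hv2⟩ := exists_coeffStep hμ hδ
  have hev : ∀ {u w : G.carrier → ℂ}, (∀ g ∈ W, u g = w g) → ∀ g ∈ W, u =ᶠ[nhds g] w :=
    fun {u w} huw g hg => by
      filter_upwards [hW.mem_nhds hg] with x hx using huw x hx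
  refine ⟨fun k => v (∑ i, k i) * ∏ i, ((d i).choose (k i) : ℂ), by simpa using hv0, ?_⟩
  have hΦ : ∀ g ∈ W, multiPoly G d (fun k => v (∑ i, k i) * ∏ i, ((d i).choose (k i) : ℂ)) f g =
      ∑ b ∈ Finset.range (s.card + 1), v b * mixedProd f h s b g := fun g hg => by
    simp only [multiPoly, H.tension_f _ g hg, mixedProd]
    rw [prod_pow_eq_sum_Iic d (fun i => f i g) (fun i => h i g) v _ (by omega)]
  have hτ : ∀ g ∈ W,
      tension G (multiPoly G d (fun k => v (∑ i, k i) * ∏ i, ((d i).choose (k i) : ℂ)) f) g =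
      ∑ b ∈ Finset.range (s.card + 1), coeffStep μ s.card v b * mixedProd f h s b g :=
    fun g hg => by rw [tension_congr (hev hΦ g hg), H.tension_sum_mixedProd s v hg]
  refine ⟨fun g hg => ?_, fun g hg => ?_, g₀, hg₀, ?_⟩
  · exact SmoothAt.congr (SmoothAt.sum fun b _ =>
      (H.smoothAt_mixedProd s b hg).const_mul _) (hev hΦ g hg)
  · rw [tension_congr (hev hτ g hg), H.tension_sum_mixedProd s _ hg]
    simp [hv1]
  · rw [hτ g₀ hg₀]
    simp only [mixedProd_of_f_eq_zero hf₀]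
    -- At `g₀` every `f_i` vanishes, so `P` is the monomial `(∏ h_i) X ^ δ` and only its top
    -- coefficient remains.
    rw [Finset.sum_eq_single s.card (by intro b _ hb; simp [hb]) (by simp), if_pos rfl]
    refine mul_ne_zero ?_ ?_
    · obtain ⟨b, hb⟩ := Nat.exists_eq_succ_of_ne_zero hδ
      have h1 := hv2 b
      rwa [← Nat.succ_eq_add_one, ← hb] at h1
    · rw [Ne, Multiset.prod_eq_zero_iff]
      simp [hh₀]

/-! ### Casimir elements -/

theorem skew_of_le_unitary (hG : G.carrier ≤ Matrix.unitaryGroup ι ℂ) :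
    ∀ Z ∈ G.lie, Zᴴ = -Z := fun Z hZ =>
  (exp_smul_unitary_iff Z).2 fun s => hG ((G.mem_lie_iff Z).1 hZ s)

theorem eq_sum_frob_frame (Z : G.lie) :
    (Z : Matrix ι ι ℂ) = ∑ i, frob (Z : Matrix ι ι ℂ) (frame G i) • (frame G i : Matrix ι ι ℂ) := by
  have hZ : (Z : Matrix ι ι ℂ) = ∑ i, (frame G).repr Z i • (frame G i : Matrix ι ι ℂ) := by
    have h := congrArg (fun z : G.lie => (z : Matrix ι ι ℂ)) ((frame G).sum_repr Z)
    simpa only [AddSubmonoidClass.coe_finsetSum, Submodule.coe_smul] using h.symm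
  have h : ∀ i, frob (Z : Matrix ι ι ℂ) (frame G i) = (frame G).repr Z i := fun i => by
    have h1 : frob (Z : Matrix ι ι ℂ) (frame G i) =
        ∑ j, (frame G).repr Z j * frob (frame G j : Matrix ι ι ℂ) (frame G i) := by
      conv_lhs => rw [hZ]
      simp [frob, Finset.sum_mul, Matrix.trace_sum, Matrix.trace_smul]
    rw [h1]
    simp [frame_orthonormal]
  simp only [h]
  exact hZ

/-- For skew-Hermitian matrices `tr(Z X)` is real and equals `-⟨Z, X⟩`, so this is the orthonormal
expansion of `Z` with a sign. -/
theorem sum_trace_frame_of_mem (hG : ∀ Z ∈ G.lie, Zᴴ = -Z) {Z : Matrix ι ι ℂ} (hZ : Z ∈ G.lie) :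
    ∑ i, (Z * (frame G i : Matrix ι ι ℂ)).trace • (frame G i : Matrix ι ι ℂ) = -Z := by
  refine Eq.trans ?_ (congrArg Neg.neg (eq_sum_frob_frame ⟨Z, hZ⟩)).symm
  rw [← Finset.sum_neg_distrib]
  refine Finset.sum_congr rfl fun i _ => ?_
  have hF := hG _ (frame G i).2
  have him : (Z * (frame G i : Matrix ι ι ℂ)).trace.im = 0 := by
    rw [← Complex.conj_eq_iff_im]
    change star _ = _
    rw [← Matrix.trace_conjTranspose, Matrix.conjTranspose_mul, hF, hG Z hZ, neg_mul_neg,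
      Matrix.trace_mul_comm]
  have h : (Z * (frame G i : Matrix ι ι ℂ)).trace = ((-frob Z (frame G i) : ℝ) : ℂ) := by
    apply Complex.ext
    · rw [frob, hF]
      simp
    · simpa using him
  rw [h, ← neg_smul]
  ext p q
  simp

/-- `π` is the projection onto the complexification of the Lie algebra, along the complement that
is orthogonal to it for the trace form. -/
def IsLieProj (G : MatrixLieGroup ι) (π : Matrix ι ι ℂ → Matrix ι ι ℂ) : Prop :=
  ∀ B, (∃ Z ∈ G.lie, ∃ Z' ∈ G.lie, π B = Z + Complex.I • Z') ∧
    ∀ Z ∈ G.lie, (π B * Z).trace = (B * Z).trace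

theorem IsLieProj.sum_trace_frame {π : Matrix ι ι ℂ → Matrix ι ι ℂ} (hπ : IsLieProj G π)
    (hG : ∀ Z ∈ G.lie, Zᴴ = -Z) (B : Matrix ι ι ℂ) :
    ∑ i, (B * (frame G i : Matrix ι ι ℂ)).trace • (frame G i : Matrix ι ι ℂ) = -π B := by
  obtain ⟨⟨Z, hZ, Z', hZ', h⟩, hB⟩ := hπ B
  simp only [← hB _ (frame G _).2]
  rw [h, neg_add, ← smul_neg, ← sum_trace_frame_of_mem hG hZ, ← sum_trace_frame_of_mem hG hZ',
    Finset.smul_sum, ← Finset.sum_add_distrib]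
  refine Finset.sum_congr rfl fun i _ => ?_
  rw [Matrix.add_mul, Matrix.trace_add, add_smul, Matrix.smul_mul, Matrix.trace_smul, smul_assoc]

/-- Take `B = c bᵀ` in `∑ tr(B X_i) X_i = -π(B)`, since `tr(c bᵀ X) = b ⬝ X c`. -/
theorem IsLieProj.sum_mul {π : Matrix ι ι ℂ → Matrix ι ι ℂ} (hπ : IsLieProj G π)
    (hG : ∀ Z ∈ G.lie, Zᴴ = -Z) (b c b' c' : ι → ℂ) :
    ∑ i, (b ⬝ᵥ ((frame G i : Matrix ι ι ℂ) *ᵥ c)) * (b' ⬝ᵥ ((frame G i : Matrix ι ι ℂ) *ᵥ c')) =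
      -(b' ⬝ᵥ (π (Matrix.vecMulVec c b) *ᵥ c')) := by
  have h := congrArg (fun M => b' ⬝ᵥ (M *ᵥ c')) (hπ.sum_trace_frame hG (Matrix.vecMulVec c b))
  simp only [Matrix.sum_mulVec, dotProduct_sum, Matrix.smul_mulVec, dotProduct_smul,
    Matrix.neg_mulVec, dotProduct_neg, smul_eq_mul, Matrix.vecMulVec_mul,
    Matrix.trace_vecMulVec] at h
  rw [← h]
  refine Finset.sum_congr rfl fun i _ => ?_
  rw [Matrix.dotProduct_mulVec, dotProduct_comm c]

/-- Inserting `∑ e_k e_kᵀ = 1` between the two factors `X_i` reduces the Casimir operator to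
`sum_mul`. -/
theorem IsLieProj.sum_sq {π : Matrix ι ι ℂ → Matrix ι ι ℂ} (hπ : IsLieProj G π)
    (hG : ∀ Z ∈ G.lie, Zᴴ = -Z) {lam : ℂ}
    (h : ∀ b c : ι → ℂ, ∑ k, Pi.single k 1 ⬝ᵥ (π (Matrix.vecMulVec (Pi.single k 1) b) *ᵥ c) =
      -lam * (b ⬝ᵥ c)) (c : ι → ℂ) :
    ∑ i, (frame G i : Matrix ι ι ℂ) *ᵥ ((frame G i : Matrix ι ι ℂ) *ᵥ c) = lam • c := by
  funext p
  have h1 := h (Pi.single p 1) c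
  rw [← neg_inj, ← Finset.sum_neg_distrib] at h1
  simp only [← hπ.sum_mul hG] at h1
  rw [Finset.sum_comm] at h1
  simp only [single_dotProduct, one_mul, Matrix.mulVec_single_one, neg_mul, neg_neg] at h1
  rw [Finset.sum_apply, Pi.smul_apply, smul_eq_mul, ← h1]
  rfl

/-- The Lie algebra acts irreducibly. -/
def IsLieIrreducible (G : MatrixLieGroup ι) : Prop :=
  ∀ S : Submodule ℂ (ι → ℂ), (∀ Z ∈ G.lie, ∀ c ∈ S, Z *ᵥ c ∈ S) → S ≠ ⊥ → S = ⊤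

theorem IsLieProj.mulVec_mem {π : Matrix ι ι ℂ → Matrix ι ι ℂ} (hπ : IsLieProj G π)
    {S : Submodule ℂ (ι → ℂ)} (hS : ∀ Z ∈ G.lie, ∀ c ∈ S, Z *ᵥ c ∈ S) (B : Matrix ι ι ℂ)
    {c : ι → ℂ} (hc : c ∈ S) : π B *ᵥ c ∈ S := by
  obtain ⟨⟨Z, hZ, Z', hZ', h⟩, -⟩ := hπ B
  rw [h, Matrix.add_mulVec, Matrix.smul_mulVec]
  exact S.add_mem (hS Z hZ c hc) (S.smul_mem _ (hS Z' hZ' c hc))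

/-! ### Vanishing of matrix coefficients -/

/-- The vectors `c` for which `q ⬝ g c` vanishes on `U` form a subspace, stable under the Lie
algebra because one may differentiate along left-invariant fields inside `U`. By irreducibility it
is everything, so `qᵀ g = 0`, and `g` is invertible. -/
theorem eq_zero_of_matCoeff_eq_zero (hG : G.carrier ≤ Matrix.unitaryGroup ι ℂ)
    (hirr : IsLieIrreducible G) {q c : ι → ℂ} (hc : c ≠ 0) {U : Set G.carrier} (hU : IsOpen U)
    (hne : U.Nonempty) (h : ∀ g ∈ U, matCoeff q c g = 0) : q = 0 := by
  let S : Submodule ℂ (ι → ℂ) :=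
    { carrier := {c | ∀ g ∈ U, matCoeff q c g = 0}
      add_mem' := fun {c c'} hc hc' g hg => by
        have h1 := hc g hg
        have h2 := hc' g hg
        simp only [matCoeff] at h1 h2 ⊢
        rw [Matrix.mulVec_add, dotProduct_add, h1, h2, add_zero]
      zero_mem' := fun g _ => by simp [matCoeff]
      smul_mem' := fun r c hc g hg => by
        have h1 := hc g hg
        simp only [matCoeff] at h1 ⊢
        rw [Matrix.mulVec_smul, dotProduct_smul, h1, smul_zero] }
  have hS : S = ⊤ := by
    refine hirr S (fun Z hZ c hc g hg => ?_) fun h0 => hc ?_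
    · rw [← lieDeriv_matCoeff q c g ⟨Z, hZ⟩, ← lieDeriv_const 0 g ⟨Z, hZ⟩]
      refine lieDeriv_congr ?_ _
      filter_upwards [hU.mem_nhds hg] with x hx using hc x hx
    · have : c ∈ S := h
      rwa [h0, Submodule.mem_bot] at this
  obtain ⟨g, hg⟩ := hne
  have hq : q ᵥ* (g : Matrix ι ι ℂ) = 0 := by
    funext j
    have h1 : Pi.single j 1 ∈ S := hS ▸ Submodule.mem_top
    have h2 := h1 g hg
    rw [matCoeff, Matrix.dotProduct_mulVec, dotProduct_single_one] at h2
    exact h2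
  have hgg := Matrix.mem_unitaryGroup_iff.1 (hG g.2)
  calc q = q ᵥ* ((g : Matrix ι ι ℂ) * star (g : Matrix ι ι ℂ)) := by rw [hgg, Matrix.vecMul_one]
    _ = 0 := by rw [← Matrix.vecMul_vecMul, hq, Matrix.zero_vecMul]

theorem exists_basis_extending_pair {β : Type*} {x a : β → ℂ} (hxa : LinearIndependent ℂ ![x, a]) :
    ∃ (κ : Set (β → ℂ)) (B : Module.Basis (Fin 2 ⊕ κ) ℂ (β → ℂ)),
      B (Sum.inl 0) = x ∧ B (Sum.inl 1) = a := by
  refine ⟨_, Module.Basis.sumExtend hxa, ?_, ?_⟩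
  · simp only [Module.Basis.sumExtend, Module.Basis.reindex_apply, Module.Basis.extend_apply_self]
    rfl
  · simp only [Module.Basis.sumExtend, Module.Basis.reindex_apply, Module.Basis.extend_apply_self]
    rfl

/-- The normalisation gives, at the identity, `u_y = 1`, `f_i = 0` and `h_i = 2μ`. Forms killing `a`
make up a space of dimension `N - 1`, which is why `m < N` suffices. -/
theorem exists_linearForms {x a : ι → ℂ} (hxa : LinearIndependent ℂ ![x, a]) {m : ℕ}
    (hm : m < Fintype.card ι) :
    ∃ (y : ι → ℂ) (b : Fin m → ι → ℂ), LinearIndependent ℂ b ∧ y ⬝ᵥ x = 1 ∧ y ⬝ᵥ a = 1 ∧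
      (∀ i, b i ⬝ᵥ x = 1) ∧ ∀ i, b i ⬝ᵥ a = 0 := by
  classical
  obtain ⟨κ, B, hx, ha⟩ := exists_basis_extending_pair hxa
  have : Finite (Fin 2 ⊕ κ) := Module.Finite.finite_basis B
  have : Finite κ := Finite.of_injective (Sum.inr : _ → Fin 2 ⊕ κ) Sum.inr_injective
  have : Fintype κ := Fintype.ofFinite _
  have hcard : Fintype.card κ + 2 = Fintype.card ι := by
    have h1 := Module.finrank_eq_card_basis B
    rw [Module.finrank_pi, Fintype.card_sum, Fintype.card_fin] at h1
    omega
  let E : (Fin 2 ⊕ κ) → ι → ℂ :=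
    fun k i => B.coord k (Pi.single i 1)
  have hE : ∀ k c, E k ⬝ᵥ c = B.coord k c := fun k c => by
    conv_rhs => rw [← Finset.univ_sum_single c, map_sum]
    refine Finset.sum_congr rfl fun i _ => ?_
    have : (Pi.single i (c i) : ι → ℂ) = c i • Pi.single i 1 := by
      rw [← Pi.single_smul, smul_eq_mul, mul_one]
    rw [this, map_smul, smul_eq_mul, mul_comm]
  have hEB : ∀ k l, E k ⬝ᵥ B l = if l = k then 1 else 0 := fun k l => by
    rw [hE, Module.Basis.coord_apply, Module.Basis.repr_self, Finsupp.single_apply]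
  -- The dual vector of `x`, alone or plus the dual vector of one further basis element: `N - 1`
  -- forms, all equal to `1` on `x` and `0` on `a`.
  let b' : Option κ → ι → ℂ := fun o =>
    o.elim (E (Sum.inl 0)) fun k => E (Sum.inl 0) + E (Sum.inr k)
  have hb' : LinearIndependent ℂ b' := by
    rw [Fintype.linearIndependent_iff]
    intro r hr
    have h1 : ∀ l, ∑ o, r o * (b' o ⬝ᵥ B l) = 0 := fun l => by
      have := congrArg (fun z => z ⬝ᵥ B l) hr
      simpa only [sum_dotProduct, smul_dotProduct, smul_eq_mul, zero_dotProduct] using this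
    have h2 : ∀ k, r (some k) = 0 := fun k => by
      simpa [Fintype.sum_option, b', add_dotProduct, hEB] using h1 (Sum.inr k)
    have h3 : r none = 0 := by
      simpa [Fintype.sum_option, b', add_dotProduct, hEB, h2] using h1 (Sum.inl 0)
    rintro (_ | k)
    · exact h3
    · exact h2 k
  obtain ⟨e⟩ : Nonempty (Fin m ↪ Option κ) :=
    Function.Embedding.nonempty_of_card_le (by
      rw [Fintype.card_option, Fintype.card_fin]
      omega)
  refine ⟨E (Sum.inl 0) + E (Sum.inl 1), b' ∘ e, hb'.comp e e.injective, ?_, ?_, fun i => ?_,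
    fun i => ?_⟩
  · rw [← hx, add_dotProduct, hEB, hEB]
    simp
  · rw [← ha, add_dotProduct, hEB, hEB]
    simp
  · rw [← hx, Function.comp_apply]
    rcases e i with _ | k <;> simp [b', add_dotProduct, hEB]
  · rw [← ha, Function.comp_apply]
    rcases e i with _ | k <;> simp [b', add_dotProduct, hEB]

theorem CasimirPair.hasBiharmonicPoly {x a : ι → ℂ} {μ ν lam : ℂ}
    (H : CasimirPair G x a μ ν lam) (hμ : μ ≠ 0) (hG : G.carrier ≤ Matrix.unitaryGroup ι ℂ)
    (hirr : IsLieIrreducible G) (hxa : LinearIndependent ℂ ![x, a]) {m : ℕ}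
    (hm : m < Fintype.card ι) {d : Fin m → ℕ} (hd : d ≠ 0) : HasBiharmonicPoly G d := by
  obtain ⟨y, b, hb, hyx, hya, hbx, hba⟩ := exists_linearForms hxa hm
  have hx0 : x ≠ 0 := hxa.ne_zero 0
  have ha0 : a ≠ 0 := hxa.ne_zero 1
  have hy0 : y ≠ 0 := by
    rintro rfl
    simp at hyx
  set W : Set G.carrier := {g | matCoeff y x g ≠ 0} with hW
  have hF := H.biharmonicFamily y b
  have hWo : IsOpen W := isOpen_ne_fun (continuous_matCoeff y x) continuous_const
  have h1 : ∀ b c : ι → ℂ, matCoeff b c (1 : G.carrier) = b ⬝ᵥ c := fun b c => by simp [matCoeff]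
  have hW1 : (1 : G.carrier) ∈ W := by
    rw [hW, Set.mem_ofPred_eq, h1, hyx]
    exact one_ne_zero
  have hh1 : ∀ i, minorQuot (G := G) μ y x a (b i) 1 ≠ 0 := fun i => by
    simp [minorQuot, quotCoeff, h1, hyx, hya, hbx, hba, hμ]
  obtain ⟨c, hc0, hc⟩ := hF.exists_multiPoly hμ hWo hd hW1
    (fun i => by simp [quotCoeff, h1, hba]) hh1
  refine ⟨fun i => Matrix.vecMulVec (b i) a, Matrix.vecMulVec y x, c, _, W, ?_, hWo, ?_, ?_, ?_, ?_,
    hc0, hc⟩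
  · simp only [coeffComb_vecMulVec, hW]
  · rw [dense_iff_inter_open]
    intro U hU hne
    by_contra hemp
    refine hy0 (eq_zero_of_matCoeff_eq_zero hG hirr hx0 hU hne fun g hg => ?_)
    by_contra hg0
    exact hemp ⟨g, hg, hg0⟩
  · intro i g
    rw [coeffComb_vecMulVec, coeffComb_vecMulVec, div_eq_mul_inv]
    rfl
  · intro i
    refine ⟨hF.smooth_f i, fun g hg => ?_, 1, hW1, ?_⟩
    · rw [← hF.tension_h i g hg]
      refine tension_congr ?_
      filter_upwards [hWo.mem_nhds hg] with z hz using hF.tension_f i z hz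
    · rw [hF.tension_f i 1 hW1]
      exact hh1 i
  · rw [Fintype.linearIndependent_iff]
    intro r hr
    -- A relation among the `f_i` says that the coefficient of `∑ r_i b_i` against `a` vanishes on
    -- `W`, so `∑ r_i b_i = 0`.
    refine Fintype.linearIndependent_iff.1 hb r ?_
    refine eq_zero_of_matCoeff_eq_zero hG hirr ha0 hWo ⟨1, hW1⟩ fun g hg => ?_
    have h2 := congrFun hr ⟨g, hg⟩
    simp only [Finset.sum_apply, Pi.smul_apply, smul_eq_mul, Pi.zero_apply] at h2
    change ∑ i, r i * (matCoeff (b i) a g * (matCoeff y x g)⁻¹) = 0 at h2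
    simp only [← mul_assoc] at h2
    rw [← Finset.sum_mul] at h2
    have h3 := (mul_eq_zero.1 h2).resolve_right (inv_ne_zero hg)
    simpa only [matCoeff, sum_dotProduct, smul_dotProduct, smul_eq_mul] using h3

/-! ### The special unitary groups -/

theorem vecMulVec_mulVec_eq_smul {κ : Type*} [Fintype κ] (a b c : κ → ℂ) :
    Matrix.vecMulVec a b *ᵥ c = (b ⬝ᵥ c) • a := by
  rw [Matrix.vecMulVec_mulVec, op_smul_eq_smul]

theorem half_sub_add_half_add {κ : Type*} (C : Matrix κ κ ℂ) :
    C = (1 / 2 : ℂ) • (C - Cᴴ) + Complex.I • ((-Complex.I / 2) • (C + Cᴴ)) := by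
  rw [smul_smul, show Complex.I * (-Complex.I / 2) = 1 / 2 by
    linear_combination (-1 / 2 : ℂ) * Complex.I_mul_I]
  module

theorem conjTranspose_half_sub {κ : Type*} (C : Matrix κ κ ℂ) :
    ((1 / 2 : ℂ) • (C - Cᴴ))ᴴ = -((1 / 2 : ℂ) • (C - Cᴴ)) := by
  rw [Matrix.conjTranspose_smul, Matrix.conjTranspose_sub, Matrix.conjTranspose_conjTranspose,
    ← smul_neg, neg_sub]
  simp

theorem conjTranspose_half_add {κ : Type*} (C : Matrix κ κ ℂ) :
    ((-Complex.I / 2) • (C + Cᴴ))ᴴ = -((-Complex.I / 2) • (C + Cᴴ)) := by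
  rw [Matrix.conjTranspose_smul, Matrix.conjTranspose_add, Matrix.conjTranspose_conjTranspose,
    ← neg_smul, add_comm]
  congr 1
  simp [neg_div]

theorem suGroup_le_unitary (n : ℕ) :
    (suGroup n).carrier ≤ Matrix.unitaryGroup (Fin n) ℂ := fun _ hg =>
  (Matrix.mem_specialUnitaryGroup_iff.1 hg).1

theorem isLieProj_suGroup {n : ℕ} (hn : n ≠ 0) :
    IsLieProj (suGroup n) fun B => B - (B.trace / n) • (1 : Matrix (Fin n) (Fin n) ℂ) := by
  intro B
  have hn' : (n : ℂ) ≠ 0 := Nat.cast_ne_zero.2 hn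
  set C := B - (B.trace / n) • (1 : Matrix (Fin n) (Fin n) ℂ) with hC
  have hC0 : C.trace = 0 := by
    rw [hC, Matrix.trace_sub, Matrix.trace_smul, Matrix.trace_one, Fintype.card_fin, smul_eq_mul,
      div_mul_cancel₀ _ hn', sub_self]
  have hC0' : Cᴴ.trace = 0 := by rw [Matrix.trace_conjTranspose, hC0, star_zero]
  refine ⟨⟨_, ⟨conjTranspose_half_sub C, ?_⟩, _, ⟨conjTranspose_half_add C, ?_⟩,
    half_sub_add_half_add C⟩, fun Z hZ => ?_⟩
  · rw [Matrix.trace_smul, Matrix.trace_sub, hC0, hC0', sub_self, smul_zero]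
  · rw [Matrix.trace_smul, Matrix.trace_add, hC0, hC0', add_zero, smul_zero]
  · change (C * Z).trace = _
    rw [hC, Matrix.sub_mul, Matrix.trace_sub, Matrix.smul_mul, Matrix.one_mul, Matrix.trace_smul,
      hZ.2, smul_zero, sub_zero]

theorem casimirPair_suGroup {n : ℕ} (hn : n ≠ 0) (x a : Fin n → ℂ) :
    CasimirPair (suGroup n) x a 1 (1 / n) (1 / n - n) := by
  have hG := skew_of_le_unitary (suGroup_le_unitary n)
  have hπ := isLieProj_suGroup hn
  refine ⟨hG, hπ.sum_sq hG fun b c => ?_, fun c _ c' _ b b' => ?_⟩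
  · simp only [Matrix.sub_mulVec, vecMulVec_mulVec_eq_smul, Matrix.smul_mulVec, Matrix.one_mulVec,
      Matrix.trace_vecMulVec, dotProduct_sub, dotProduct_smul, single_dotProduct, one_mul,
      Finset.sum_sub_distrib, smul_eq_mul, Pi.single_eq_same]
    simp only [div_eq_mul_inv, mul_right_comm _ _ (_ : ℂ), ← Finset.sum_mul, dotProduct]
    simp
    ring
  · rw [hπ.sum_mul hG]
    simp only [Matrix.sub_mulVec, vecMulVec_mulVec_eq_smul, Matrix.smul_mulVec, Matrix.one_mulVec,
      Matrix.trace_vecMulVec, dotProduct_sub, dotProduct_smul, smul_eq_mul]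
    rw [dotProduct_comm c b]
    ring

/-- Modulo scalars, which preserve `S`, the complexified Lie algebra contains `w e_jᵀ`, which sends
`c` to `c_j w` for arbitrary `w`. -/
theorem isLieIrreducible_suGroup {n : ℕ} (hn : n ≠ 0) : IsLieIrreducible (suGroup n) := by
  intro S hS hne
  obtain ⟨c, hc, hc0⟩ := Submodule.exists_mem_ne_zero_of_ne_bot hne
  obtain ⟨j, hj⟩ := Function.ne_iff.1 hc0
  refine Submodule.eq_top_iff'.2 fun w => ?_
  have h := (isLieProj_suGroup hn).mulVec_mem hS (Matrix.vecMulVec w (Pi.single j 1)) hc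
  rw [Matrix.sub_mulVec, Matrix.smul_mulVec, Matrix.one_mulVec] at h
  have h1 := S.add_mem h (S.smul_mem ((Matrix.vecMulVec w (Pi.single j 1)).trace / n) hc)
  rw [sub_add_cancel, vecMulVec_mulVec_eq_smul, single_dotProduct, one_mul] at h1
  exact (S.smul_mem_iff hj).1 h1

theorem linearIndependent_pair_single {κ : Type*} [DecidableEq κ] {i j : κ} (hij : i ≠ j) :
    LinearIndependent ℂ ![(Pi.single i 1 : κ → ℂ), Pi.single j 1] := by
  rw [LinearIndependent.pair_iff]
  intro s t h
  have h1 := congrFun h i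
  have h2 := congrFun h j
  simp [hij, hij.symm] at h1 h2
  exact ⟨h1, h2⟩

theorem hasBiharmonicPoly_suGroup {n : ℕ} (hn : 2 ≤ n) {d : Fin (n - 1) → ℕ} (hd : d ≠ 0) :
    HasBiharmonicPoly (suGroup n) d := by
  have hn0 : n ≠ 0 := by omega
  have hij : (⟨0, by omega⟩ : Fin n) ≠ ⟨1, by omega⟩ := by simp
  refine (casimirPair_suGroup hn0 _ _).hasBiharmonicPoly one_ne_zero (suGroup_le_unitary n)
    (isLieIrreducible_suGroup hn0) (linearIndependent_pair_single hij) ?_ hd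
  rw [Fintype.card_fin]
  omega

/-! ### The special orthogonal groups -/

theorem soGroup_le_unitary (n : ℕ) :
    (soGroup n).carrier ≤ Matrix.unitaryGroup (Fin n) ℂ := by
  rintro _ ⟨A, hA, rfl⟩
  have h1 : A * Aᵀ = 1 := (Matrix.mem_orthogonalGroup_iff (Fin n) ℝ).1
    (Matrix.mem_specialOrthogonalGroup_iff.1 hA).1
  rw [Matrix.mem_unitaryGroup_iff]
  have h2 : star ((Complex.ofRealHom.mapMatrix : Matrix (Fin n) (Fin n) ℝ →+* _) A) =
      Complex.ofRealHom.mapMatrix Aᵀ := by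
    ext i j
    simp
  exact (congrArg _ h2).trans ((map_mul _ _ _).symm.trans (by rw [h1, map_one]))

theorem isLieProj_soGroup (n : ℕ) :
    IsLieProj (soGroup n) fun B => (1 / 2 : ℂ) • (B - Bᵀ) := by
  intro B
  refine ⟨⟨_, ⟨(1 / 2 : ℝ) • (B.map Complex.re - (B.map Complex.re)ᵀ), ?_, rfl⟩, _,
    ⟨(1 / 2 : ℝ) • (B.map Complex.im - (B.map Complex.im)ᵀ), ?_, rfl⟩, ?_⟩, ?_⟩
  · rw [Matrix.transpose_smul, Matrix.transpose_sub, Matrix.transpose_transpose, ← smul_neg,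
      neg_sub]
  · rw [Matrix.transpose_smul, Matrix.transpose_sub, Matrix.transpose_transpose, ← smul_neg,
      neg_sub]
  · ext i j
    apply Complex.ext <;> simp
  · rintro _ ⟨Y, hY, rfl⟩
    have hY' : (Y.map ((↑) : ℝ → ℂ))ᵀ = -Y.map ((↑) : ℝ → ℂ) := by
      rw [← Matrix.transpose_map, hY]
      ext
      simp
    have h : (Bᵀ * Y.map ((↑) : ℝ → ℂ)).trace = -(B * Y.map ((↑) : ℝ → ℂ)).trace := by
      rw [← Matrix.trace_transpose, Matrix.transpose_mul, Matrix.transpose_transpose, hY',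
        Matrix.neg_mul, Matrix.trace_neg, Matrix.trace_mul_comm]
    rw [Matrix.smul_mul, Matrix.trace_smul, Matrix.sub_mul, Matrix.trace_sub, h, smul_eq_mul]
    ring

/-- Skew-symmetrising `c bᵀ` produces, besides the swap term, a term proportional to `c ⬝ c'`;
isotropy of the span of `x` and `a` removes it. -/
theorem casimirPair_soGroup {n : ℕ} {x a : Fin n → ℂ} (hxx : x ⬝ᵥ x = 0) (hxa : x ⬝ᵥ a = 0)
    (haa : a ⬝ᵥ a = 0) : CasimirPair (soGroup n) x a (1 / 2) 0 ((1 - n) / 2) := by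
  have hG := skew_of_le_unitary (soGroup_le_unitary n)
  have hπ := isLieProj_soGroup n
  refine ⟨hG, hπ.sum_sq hG fun b c => ?_, fun c hc c' hc' b b' => ?_⟩
  · simp only [Matrix.sub_mulVec, vecMulVec_mulVec_eq_smul, Matrix.smul_mulVec,
      Matrix.transpose_vecMulVec, dotProduct_sub, dotProduct_smul, single_dotProduct, one_mul,
      smul_eq_mul, Pi.single_eq_same, ← Finset.mul_sum,
      Finset.sum_sub_distrib]
    simp only [dotProduct, mul_comm (c _) (b _)]
    simp
    ring
  · have h0 : c ⬝ᵥ c' = 0 := by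
      rcases hc with rfl | rfl <;> rcases hc' with rfl | rfl <;>
        first | assumption | (rw [dotProduct_comm]; assumption)
    rw [hπ.sum_mul hG]
    simp only [Matrix.sub_mulVec, vecMulVec_mulVec_eq_smul, Matrix.smul_mulVec,
      Matrix.transpose_vecMulVec, dotProduct_sub, dotProduct_smul, smul_eq_mul,
      h0]
    ring

theorem isLieIrreducible_soGroup {n : ℕ} (hn : 3 ≤ n) : IsLieIrreducible (soGroup n) := by
  intro S hS hne
  obtain ⟨c, hc, hc0⟩ := Submodule.exists_mem_ne_zero_of_ne_bot hne
  obtain ⟨j, hj⟩ := Function.ne_iff.1 hc0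
  have hrot : ∀ (i k : Fin n) (c : Fin n → ℂ), c ∈ S →
      c k • (Pi.single i 1 : Fin n → ℂ) - c i • (Pi.single k 1 : Fin n → ℂ) ∈ S :=
    fun i k c hc => by
      have h := (isLieProj_soGroup n).mulVec_mem hS
        (Matrix.vecMulVec (Pi.single i 1) (Pi.single k 1)) hc
      rw [Matrix.smul_mulVec, S.smul_mem_iff (by norm_num), Matrix.sub_mulVec,
        Matrix.transpose_vecMulVec, vecMulVec_mulVec_eq_smul, vecMulVec_mulVec_eq_smul,
        single_dotProduct, single_dotProduct, one_mul, one_mul] at h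
      exact h
  have h1 : ∀ k, k ≠ j → (Pi.single k 1 : Fin n → ℂ) ∈ S := fun k hk => by
    obtain ⟨i, hi⟩ : ∃ i : Fin n, i ∉ ({j, k} : Finset (Fin n)) := by
      by_contra! h
      have h2 := Finset.card_le_card (fun i _ => h i : Finset.univ ⊆ ({j, k} : Finset (Fin n)))
      have h3 := Finset.card_le_two (a := j) (b := k)
      rw [Finset.card_univ, Fintype.card_fin] at h2
      omega
    simp only [Finset.mem_insert, Finset.mem_singleton, not_or] at hi
    -- Rotating through a third index `i` cancels the unwanted coordinate and leaves `c_j e_k`; this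
    -- is where `3 ≤ n` enters.
    have h2 := hrot k i _ (hrot i j c hc)
    simpa [hi.1, hi.2, hk, Ne.symm hi.1, Ne.symm hi.2, Ne.symm hk, S.smul_mem_iff hj] using h2
  have h2 : ∀ k, (Pi.single k 1 : Fin n → ℂ) ∈ S := fun k => by
    by_cases hk : k = j
    · obtain ⟨i, hi⟩ : ∃ i : Fin n, i ≠ j := by
        have : Nontrivial (Fin n) := Fin.nontrivial_iff_two_le.2 (by omega)
        exact exists_ne j
      have h3 := hrot j i _ (h1 i hi)
      rw [hk]
      simpa [hi, Ne.symm hi] using h3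
    · exact h1 k hk
  refine Submodule.eq_top_iff'.2 fun w => ?_
  rw [← Finset.univ_sum_single w]
  refine S.sum_mem fun k _ => ?_
  have : (Pi.single k (w k) : Fin n → ℂ) = w k • Pi.single k 1 := by
    rw [← Pi.single_smul, smul_eq_mul, mul_one]
  rw [this]
  exact S.smul_mem _ (h2 k)

theorem hasBiharmonicPoly_soGroup {n : ℕ} (hn : 4 ≤ n) {d : Fin (n - 1) → ℕ} (hd : d ≠ 0) :
    HasBiharmonicPoly (soGroup n) d := by
  obtain ⟨i, hi⟩ : ∃ i : Fin 4 → Fin n, Function.Injective i :=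
    ⟨Fin.castLE hn, Fin.castLE_injective hn⟩
  -- Two independent vectors spanning a totally isotropic plane; four coordinates are used.
  let x : Fin n → ℂ := Pi.single (i 0) 1 + Pi.single (i 1) Complex.I
  let a : Fin n → ℂ := Pi.single (i 2) 1 + Pi.single (i 3) Complex.I
  have hxx : x ⬝ᵥ x = 0 := by simp [x, dotProduct_add, hi.eq_iff]
  have hxa : x ⬝ᵥ a = 0 := by simp [x, a, dotProduct_add, hi.eq_iff]
  have haa : a ⬝ᵥ a = 0 := by simp [a, dotProduct_add, hi.eq_iff]
  refine (casimirPair_soGroup hxx hxa haa).hasBiharmonicPoly (by norm_num) (soGroup_le_unitary _)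
    (isLieIrreducible_soGroup (by omega)) ?_ ?_ hd
  · rw [LinearIndependent.pair_iff]
    intro s t h
    have h1 := congrFun h (i 0)
    have h2 := congrFun h (i 2)
    simp [x, a, hi.eq_iff] at h1 h2
    exact ⟨h1, h2⟩
  · rw [Fintype.card_fin]
    omega

/-! ### The quaternionic unitary groups -/

/-- The matrix of the standard symplectic form. -/
def sympForm (n : ℕ) : Matrix (Fin n ⊕ Fin n) (Fin n ⊕ Fin n) ℂ := Matrix.fromBlocks 0 1 (-1) 0

theorem sympForm_mul_self (n : ℕ) : sympForm n * sympForm n = -1 := by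
  rw [sympForm, Matrix.fromBlocks_multiply, ← Matrix.fromBlocks_one, Matrix.fromBlocks_neg]
  simp

theorem transpose_sympForm (n : ℕ) : (sympForm n)ᵀ = -sympForm n := by
  rw [sympForm, Matrix.fromBlocks_transpose, Matrix.fromBlocks_neg]
  simp

theorem conjTranspose_sympForm (n : ℕ) : (sympForm n)ᴴ = -sympForm n := by
  rw [sympForm, Matrix.fromBlocks_conjTranspose, Matrix.fromBlocks_neg]
  simp

theorem spGroup_le_unitary (n : ℕ) :
    (spGroup n).carrier ≤ Matrix.unitaryGroup (Fin n ⊕ Fin n) ℂ :=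
  inf_le_left

/-- For skew-Hermitian `Z` the entrywise conjugate is `-Zᵀ`, so the quaternionic condition becomes
complex-linear in `Z` and passes to the complexification. -/
theorem mem_lie_spGroup {n : ℕ} {Z : Matrix (Fin n ⊕ Fin n) (Fin n ⊕ Fin n) ℂ} :
    Z ∈ (spGroup n).lie ↔ Zᴴ = -Z ∧ sympForm n * Zᵀ * sympForm n = Z := by
  refine and_congr_right fun hZ => ?_
  have h : Z.map star = -Zᵀ := by
    rw [← Matrix.transpose_neg, ← hZ]
    rfl
  rw [mem_quaternionic_iff, h, ← sympForm]
  constructor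
  · intro h1
    have h2 : sympForm n * Zᵀ = -(Z * sympForm n) := by rw [← h1, Matrix.mul_neg, neg_neg]
    rw [h2, Matrix.neg_mul, Matrix.mul_assoc, sympForm_mul_self, Matrix.mul_neg, Matrix.mul_one,
      neg_neg]
  · intro h1
    conv_rhs => rw [← h1]
    rw [Matrix.mul_assoc _ _ (sympForm n), sympForm_mul_self, Matrix.mul_neg, Matrix.mul_neg,
      Matrix.mul_one]

/-- The map `B ↦ J Bᵀ J` is an involution fixing the Lie algebra and preserving the trace pairing
with it; the projection is the average with this involution. -/
theorem isLieProj_spGroup (n : ℕ) :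
    IsLieProj (spGroup n) fun B => (1 / 2 : ℂ) • (B + sympForm n * Bᵀ * sympForm n) := by
  have hJJ := sympForm_mul_self n
  have hJ2 : ∀ M : Matrix (Fin n ⊕ Fin n) (Fin n ⊕ Fin n) ℂ,
      sympForm n * (sympForm n * M * sympForm n) * sympForm n = M := fun M => by
    rw [Matrix.mul_assoc (sympForm n) M, ← Matrix.mul_assoc (sympForm n) (sympForm n), hJJ,
      Matrix.mul_assoc, Matrix.mul_assoc, hJJ]
    simp
  have hJT : ∀ M : Matrix (Fin n ⊕ Fin n) (Fin n ⊕ Fin n) ℂ,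
      (sympForm n * M * sympForm n)ᵀ = sympForm n * Mᵀ * sympForm n := fun M => by
    rw [Matrix.transpose_mul, Matrix.transpose_mul, transpose_sympForm, Matrix.mul_neg,
      Matrix.neg_mul, Matrix.mul_neg, neg_neg, Matrix.mul_assoc]
  have hJH : ∀ M : Matrix (Fin n ⊕ Fin n) (Fin n ⊕ Fin n) ℂ,
      (sympForm n * M * sympForm n)ᴴ = sympForm n * Mᴴ * sympForm n := fun M => by
    rw [Matrix.conjTranspose_mul, Matrix.conjTranspose_mul, conjTranspose_sympForm, Matrix.mul_neg,
      Matrix.neg_mul, Matrix.mul_neg, neg_neg, Matrix.mul_assoc]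
  intro B
  set C := (1 / 2 : ℂ) • (B + sympForm n * Bᵀ * sympForm n) with hC
  have hCs : sympForm n * Cᵀ * sympForm n = C := by
    rw [hC, Matrix.transpose_smul, Matrix.transpose_add, hJT, Matrix.transpose_transpose,
      Matrix.mul_smul, Matrix.smul_mul, Matrix.mul_add, Matrix.add_mul, hJ2, add_comm]
  have hCs' : sympForm n * Cᴴᵀ * sympForm n = Cᴴ := by
    conv_rhs => rw [← hCs, hJH]
    rfl
  refine ⟨⟨_, mem_lie_spGroup.2 ⟨conjTranspose_half_sub C, ?_⟩, _,
    mem_lie_spGroup.2 ⟨conjTranspose_half_add C, ?_⟩, half_sub_add_half_add C⟩, fun Z hZ => ?_⟩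
  · rw [Matrix.transpose_smul, Matrix.transpose_sub, Matrix.mul_smul, Matrix.smul_mul,
      Matrix.mul_sub, Matrix.sub_mul, hCs, hCs']
  · rw [Matrix.transpose_smul, Matrix.transpose_add, Matrix.mul_smul, Matrix.smul_mul,
      Matrix.mul_add, Matrix.add_mul, hCs, hCs']
  · change (C * Z).trace = _
    have h : (sympForm n * Bᵀ * sympForm n * Z).trace = (B * Z).trace := by
      conv_rhs => rw [← (mem_lie_spGroup.1 hZ).2]
      rw [← Matrix.trace_transpose, Matrix.transpose_mul, hJT, Matrix.transpose_transpose,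
        Matrix.trace_mul_comm, Matrix.mul_assoc, Matrix.mul_assoc, Matrix.trace_mul_comm]
      simp only [Matrix.mul_assoc]
    rw [hC, Matrix.smul_mul, Matrix.trace_smul, Matrix.add_mul, Matrix.trace_add, h, smul_eq_mul]
    ring

theorem dotProduct_sympProj_mulVec {n : ℕ} (b c b' c' : Fin n ⊕ Fin n → ℂ) :
    b' ⬝ᵥ (((1 / 2 : ℂ) • (Matrix.vecMulVec c b +
      sympForm n * (Matrix.vecMulVec c b)ᵀ * sympForm n)) *ᵥ c') =
      1 / 2 * ((b ⬝ᵥ c') * (b' ⬝ᵥ c) +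
        (b' ⬝ᵥ (sympForm n *ᵥ b)) * (c ⬝ᵥ (sympForm n *ᵥ c'))) := by
  rw [Matrix.smul_mulVec, Matrix.add_mulVec, ← Matrix.mulVec_mulVec, ← Matrix.mulVec_mulVec,
    Matrix.transpose_vecMulVec, vecMulVec_mulVec_eq_smul, vecMulVec_mulVec_eq_smul,
    Matrix.mulVec_smul, dotProduct_smul, dotProduct_add, dotProduct_smul, dotProduct_smul]
  simp only [smul_eq_mul]
  ring

theorem casimirPair_spGroup_of_sum_mul {n : ℕ} {x a : Fin n ⊕ Fin n → ℂ} {μ ν : ℂ}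
    (h : ∀ c ∈ ({x, a} : Set (Fin n ⊕ Fin n → ℂ)), ∀ c' ∈ ({x, a} : Set (Fin n ⊕ Fin n → ℂ)),
      ∀ b b', -(1 / 2 * ((b ⬝ᵥ c') * (b' ⬝ᵥ c) +
        (b' ⬝ᵥ (sympForm n *ᵥ b)) * (c ⬝ᵥ (sympForm n *ᵥ c')))) =
        -μ * ((b ⬝ᵥ c') * (b' ⬝ᵥ c)) + ν * ((b ⬝ᵥ c) * (b' ⬝ᵥ c'))) :
    CasimirPair (spGroup n) x a μ ν (-(2 * n + 1) / 2) := by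
  have hG := skew_of_le_unitary (spGroup_le_unitary n)
  have hπ := isLieProj_spGroup n
  refine ⟨hG, hπ.sum_sq hG fun b c => ?_, fun c hc c' hc' b b' => ?_⟩
  · have h1 : ∑ k, (sympForm n *ᵥ b) k * (sympForm n *ᵥ c) k = b ⬝ᵥ c := by
      change (sympForm n *ᵥ b) ⬝ᵥ (sympForm n *ᵥ c) = _
      rw [Matrix.dotProduct_mulVec, ← Matrix.mulVec_transpose, transpose_sympForm,
        Matrix.mulVec_mulVec, Matrix.neg_mul, sympForm_mul_self, neg_neg, Matrix.one_mulVec]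
    simp only [dotProduct_sympProj_mulVec]
    simp only [single_dotProduct, one_mul, Pi.single_eq_same, mul_one,
      ← Finset.mul_sum, Finset.sum_add_distrib, h1]
    simp
    ring
  · rw [hπ.sum_mul hG, dotProduct_sympProj_mulVec, h c hc c' hc']

theorem casimirPair_spGroup {n : ℕ} {x a : Fin n ⊕ Fin n → ℂ}
    (hxx : x ⬝ᵥ (sympForm n *ᵥ x) = 0) (hxa : x ⬝ᵥ (sympForm n *ᵥ a) = 0)
    (hax : a ⬝ᵥ (sympForm n *ᵥ x) = 0) (haa : a ⬝ᵥ (sympForm n *ᵥ a) = 0) :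
    CasimirPair (spGroup n) x a (1 / 2) 0 (-(2 * n + 1) / 2) := by
  refine casimirPair_spGroup_of_sum_mul fun c hc c' hc' b b' => ?_
  have h0 : c ⬝ᵥ (sympForm n *ᵥ c') = 0 := by
    rcases hc with rfl | rfl <;> rcases hc' with rfl | rfl <;> assumption
  rw [h0]
  ring

/-- There is no isotropic plane in dimension two. Instead, the two-dimensional determinant identity
rewrites the symplectic term through swap and plain product, giving the constants of `SU(2)`. -/
theorem casimirPair_spGroup_one (x a : Fin 1 ⊕ Fin 1 → ℂ) :
    CasimirPair (spGroup 1) x a 1 (1 / 2) (-(2 * (1 : ℕ) + 1) / 2) := by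
  refine casimirPair_spGroup_of_sum_mul fun c _ c' _ b b' => ?_
  simp [sympForm, dotProduct, Matrix.mulVec, Fintype.sum_sum_type]
  ring

/-- The rank-one matrix `z (Jz)ᵀ` lies in the complexified Lie algebra and sends `c` to `(Jz ⬝ c)
z`. So `S` contains every `z` off the hyperplane `Jz ⬝ c = 0`, and these span. -/
theorem isLieIrreducible_spGroup (n : ℕ) : IsLieIrreducible (spGroup n) := by
  intro S hS hne
  obtain ⟨c, hc, hc0⟩ := Submodule.exists_mem_ne_zero_of_ne_bot hne
  have hmem : ∀ z : Fin n ⊕ Fin n → ℂ, (sympForm n *ᵥ z) ⬝ᵥ c ≠ 0 → z ∈ S := fun z hz => by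
    have h := (isLieProj_spGroup n).mulVec_mem hS (Matrix.vecMulVec z (sympForm n *ᵥ z)) hc
    have h1 : ((1 / 2 : ℂ) • (Matrix.vecMulVec z (sympForm n *ᵥ z) +
        sympForm n * (Matrix.vecMulVec z (sympForm n *ᵥ z))ᵀ * sympForm n)) =
        Matrix.vecMulVec z (sympForm n *ᵥ z) := by
      rw [Matrix.transpose_vecMulVec, Matrix.mul_vecMulVec, Matrix.vecMulVec_mul,
        Matrix.mulVec_mulVec, sympForm_mul_self, ← Matrix.mulVec_transpose, transpose_sympForm,
        Matrix.neg_mulVec, Matrix.neg_mulVec, Matrix.one_mulVec, Matrix.neg_vecMulVec,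
        Matrix.vecMulVec_neg, neg_neg]
      module
    rw [h1, vecMulVec_mulVec_eq_smul] at h
    exact (S.smul_mem_iff hz).1 h
  obtain ⟨z₀, hz₀⟩ : ∃ z, (sympForm n *ᵥ z) ⬝ᵥ c ≠ 0 := by
    by_contra! h
    refine hc0 (funext fun i => ?_)
    have h1 := h (sympForm n *ᵥ Pi.single i 1)
    rw [Matrix.mulVec_mulVec, sympForm_mul_self, Matrix.neg_mulVec, Matrix.one_mulVec,
      neg_dotProduct, single_dotProduct, one_mul, neg_eq_zero] at h1
    exact h1
  refine Submodule.eq_top_iff'.2 fun z => ?_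
  by_cases hz : (sympForm n *ᵥ z) ⬝ᵥ c = 0
  · have h1 : z + z₀ ∈ S := hmem _ (by rwa [Matrix.mulVec_add, add_dotProduct, hz, zero_add])
    exact (S.add_mem_iff_left (hmem z₀ hz₀)).1 h1
  · exact hmem z hz

theorem hasBiharmonicPoly_spGroup {n : ℕ} (hn : 1 ≤ n) {d : Fin (max (n - 1) 1) → ℕ}
    (hd : d ≠ 0) : HasBiharmonicPoly (spGroup n) d := by
  have hm : max (n - 1) 1 < Fintype.card (Fin n ⊕ Fin n) := by
    rw [Fintype.card_sum, Fintype.card_fin]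
    omega
  rcases hn.eq_or_lt with rfl | hn
  · have hij : (Sum.inl 0 : Fin 1 ⊕ Fin 1) ≠ Sum.inr 0 := Sum.inl_ne_inr
    exact (casimirPair_spGroup_one _ _).hasBiharmonicPoly one_ne_zero (spGroup_le_unitary 1)
      (isLieIrreducible_spGroup 1) (linearIndependent_pair_single hij) hm hd
  · have hij : (Sum.inl ⟨0, by omega⟩ : Fin n ⊕ Fin n) ≠ Sum.inl ⟨1, by omega⟩ := by simp
    -- Basis vectors of the first block span a Lagrangian subspace, so two of them give an isotropic
    -- pair once `n ≥ 2`.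
    have h0 : ∀ i j : Fin n, (Pi.single (Sum.inl i) 1 : Fin n ⊕ Fin n → ℂ) ⬝ᵥ
        (sympForm n *ᵥ Pi.single (Sum.inl j) 1) = 0 := fun i j => by
      simp [sympForm]
    exact (casimirPair_spGroup (h0 _ _) (h0 _ _) (h0 _ _) (h0 _ _)).hasBiharmonicPoly (by norm_num)
      (spGroup_le_unitary n) (isLieIrreducible_spGroup n) (linearIndependent_pair_single hij) hm hd

end MatrixGroup

end

theorem theorem1p1 :
    (∀ n : ℕ, 2 ≤ n → ∀ d : Fin (n - 1) → ℕ, d ≠ 0 →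
      MatrixGroup.HasBiharmonicPoly (MatrixGroup.suGroup n) d) ∧
    (∀ n : ℕ, 1 ≤ n → ∀ d : Fin (max (n - 1) 1) → ℕ, d ≠ 0 →
      MatrixGroup.HasBiharmonicPoly (MatrixGroup.spGroup n) d) ∧
    (∀ n : ℕ, 4 ≤ n → ∀ d : Fin (n - 1) → ℕ, d ≠ 0 →
      MatrixGroup.HasBiharmonicPoly (MatrixGroup.soGroup n) d) := by
  exact ⟨fun _ hn _ hd => MatrixGroup.hasBiharmonicPoly_suGroup hn hd,
    fun _ hn _ hd => MatrixGroup.hasBiharmonicPoly_spGroup hn hd,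
    fun _ hn _ hd => MatrixGroup.hasBiharmonicPoly_soGroup hn hd⟩
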